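/- Let $S$ be a finite set and $R$ a finite set of relations on $S$, and suppose that the group $\overline\Lambda=\langle S\mid R\rangle$ is abelian. Let $\le$ be a partial order on $\overline\Lambda$ that is compatible with the group operation ($a_1\le a_2$ and $b_1\le b_2$ imply $a_1b_1\le a_2b_2$), and suppose that the positive cone $\Lambda=\{x\in\overline\Lambda : x\ge 1\}$ is the submonoid of $\overline\Lambda$ generated by (the image of) $S$. Regard $\Lambda$ as a poset with the induced order. Definitions. An upper neighbor of $\alpha\in\Lambda$ is an element $\beta>\alpha$ with no $x\in\Lambda$ satisfying $\alpha<x<\beta$. The poset $\Lambda$ is locally finite if $\{x\in\Lambda: x\le\alpha\}$ is finite for every $\alpha$, there are finitely many minimal elements, and every element has finitely many upper neighbors. A path is a possibly empty finite sequence $\pi=(\pi_1,\dots,\pi_n)$ in $\Lambda$ with $\pi_1$ minimal and each $\pi_{i+1}$ an upper neighbor of $\pi_i$; its length is $\ell(\pi)=n$. $\Pi(A)$ is the set of paths with all terms in $A$, and $\Pi_m(A)$ is the set of those paths in $\Pi(A)$ that are not properly extended by another path in $\Pi(A)$. $\Lambda$ is steady if there is $C\ge1$ such that $\max_{\pi\in\Pi_m(\{y\le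 x\})}\ell(\pi)\le C\min_{\pi\in\Pi_m(\{y\le x\})}\ell(\pi)$ for all $x\in\Lambda$ (in particular the maximum and minimum exist). $L(\Lambda)$ is the set of finite lower sets of $\Lambda$. For $A\in L(\Lambda)$ put $\ell(A)=\max_{\pi\in\Pi(A)}\ell(\pi)$ and $\kappa(A)=\log|\Pi_m(A)|$. For $A,B\subseteq\Lambda$ put $AB=\{x\in\Lambda:\exists a\in A,\,b\in B,\ x\le ab\}$, $A^0=\{1\}$ and $A^{n}=A\,A^{n-1}$. Given rates $\lambda_x\in(0,\infty)$, $x\in\Lambda$, let $X_t$ be the (càdlàg, non-explosive) Markov process on the countable set $L(\Lambda)$ with $X_0=\emptyset$ and generator $$(\mathcal Lf)(A)=\sum_{\alpha\ \text{minimal in}\ \Lambda\setminus A}\lambda_\alpha\bigl(f(A\cup\{\alpha\})-f(A)\bigr),$$ in the sense that $f(X_t)-\int_0^t(\mathcal Lf)(X_s)\,ds$ is a martingale for every bounded $f:L(\Lambda)\to\mathbb R$ with $\mathcal Lf$ bounded. Let $\tau_A=\inf\{t\ge0: A\subseteq X_t\}$. Claim. $\Lambda$ is steady and locally finite. Moreover,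 suppose that $\lambda_-:=\inf_{x\in\Lambda}\lambda_x>0$, that $\sup_{x\in\Lambda}\lambda_x<\infty$, and that $\lambda_x\ge\lambda_y$ whenever $x\le y$ in $\Lambda$. Then for every $A\in L(\Lambda)$ all the expectations $\mathbb E[\tau_{A^n}]$ are finite, the following three limits exist and are finite, and $$g(A):=\lim_{n\to\infty}\frac{\mathbb E[\tau_{A^n}]}{n}\ \le\ \frac1{\lambda_-}\left(\sqrt{\lim_{n\to\infty}\tfrac1n\kappa(A^n)}+\sqrt{\lim_{n\to\infty}\tfrac1n\ell(A^n)}\right)^2 .$$ The value $g(A)$ depends only on $\Lambda$, the rates and $A$. -/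

import Mathlib

open MeasureTheory ProbabilityTheory Filter Topology
open scoped NNReal ENNReal

namespace CrystalGrowth

section Poset

variable {Λ : Type*} [PartialOrder Λ]

/-- Local finiteness of a poset, in the sense used for crystal growth. The upper neighbors of `a`
are the elements covering `a`. -/
structure LocFinite (Λ : Type*) [PartialOrder Λ] : Prop where
  finite_below : ∀ a : Λ, {x : Λ | x ≤ a}.Finite
  finite_minimal : {x : Λ | IsMin x}.Finite
  finite_upper : ∀ a : Λ, {b : Λ | a ⋖ b}.Finite

/-- A path: a possibly empty sequence that starts at a minimal element and in which every term is
an upper neighbor of the preceding term. -/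
def IsPath (p : List Λ) : Prop :=
  (∀ x ∈ p.head?, IsMin x) ∧ p.IsChain (· ⋖ ·)

/-- The set `Π(A)` of paths all of whose terms lie in `A`. -/
def paths (A : Set Λ) : Set (List Λ) :=
  {p | IsPath p ∧ ∀ x ∈ p, x ∈ A}

/-- The set `Π_m(A)` of maximal paths in `A`: those that no other path in `A` extends. -/
def maxPaths (A : Set Λ) : Set (List Λ) :=
  {p | p ∈ paths A ∧ ∀ q ∈ paths A, p <+: q → q = p}

/-- The length `ℓ(A)`, the maximal number of terms of a path in `A` (for finite `A`). -/
noncomputable def len (A : Set Λ) : ℕ :=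
  sSup (List.length '' paths A)

/-- The width `κ(A)`, the logarithm of the number of maximal paths in `A` (for finite `A`). -/
noncomputable def width (A : Set Λ) : ℝ :=
  Real.log ((maxPaths A).ncard : ℝ)

/-- Steadiness: for some `C ≥ 1`, for all `x`, the maximum of `ℓ(p)` over the maximal paths `p`
in `{y | y ≤ x}` is at most `C` times the minimum. That there is a maximal path at all is part of
the definition, so the minimum exists, and the inequality makes the maximum exist. -/
def Steady (Λ : Type*) [PartialOrder Λ] : Prop :=
  ∃ C : ℝ, 1 ≤ C ∧ ∀ x : Λ, (maxPaths (Set.Iic x)).Nonempty ∧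
    ∀ p ∈ maxPaths (Set.Iic x), ∀ q ∈ maxPaths (Set.Iic x), (p.length : ℝ) ≤ C * (q.length : ℝ)

/-- The set `L(Λ)` of finite lower sets. -/
@[ext]
structure FinLower (Λ : Type*) [PartialOrder Λ] where
  carrier : Set Λ
  lower : IsLowerSet carrier
  finite : carrier.Finite

namespace FinLower

/-- The empty lower set. -/
def empty : FinLower Λ := ⟨∅, isLowerSet_empty, Set.finite_empty⟩

/-- The cells available for growth: the minimal elements of `Λ \ A`. -/
def growth (A : FinLower Λ) : Set Λ := {a | Minimal (fun x => x ∉ A.carrier) a}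

/-- `A ∪ {a}` for an available cell `a`. -/
def add (A : FinLower Λ) (a : A.growth) : FinLower Λ where
  carrier := insert (a : Λ) A.carrier
  lower := by
    intro x y hyx hx
    rcases hx with rfl | hx
    · by_cases hy : y ∈ A.carrier
      · exact Or.inr hy
      · exact Or.inl (le_antisymm hyx (a.2.2 hy hyx))
    · exact Or.inr (A.lower hyx hx)
  finite := A.finite.insert _

end FinLower

/-- The generator `(𝓛 f)(A) = ∑ λ_a (f (A ∪ {a}) - f A)`, summed over the available cells `a` of
`A` (a finite set when `Λ` is locally finite). -/
noncomputable def generator (rate : Λ → ℝ) (f : FinLower Λ → ℝ) (A : FinLower Λ) : ℝ :=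
  ∑ᶠ a : A.growth, rate a * (f (A.add a) - f A)

/-- `X` is a crystal growth process with the given rates, started at `∅`: an adapted process with
values in the discrete space `L(Λ)`, whose paths are right-continuous with left limits (so that it
does not explode), and which solves the martingale problem for the generator on the bounded
functions `f` for which `𝓛 f` is bounded. -/
structure IsGrowthProcess {Ω : Type*} {m : MeasurableSpace Ω} (rate : Λ → ℝ) (P : Measure Ω)
    (F : Filtration ℝ≥0 m) (X : ℝ≥0 → Ω → FinLower Λ) : Prop where
  adapted : ∀ (t : ℝ≥0) (U : Set (FinLower Λ)), MeasurableSet[F t] (X t ⁻¹' U)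
  start : ∀ ω, X 0 ω = FinLower.empty
  right_cont : ∀ ω t, ∀ᶠ s in 𝓝[>] t, X s ω = X t ω
  left_lim : ∀ ω (t : ℝ≥0), ∃ B, ∀ᶠ s in 𝓝[<] t, X s ω = B
  martingale : ∀ f : FinLower Λ → ℝ, (∃ K, ∀ A, |f A| ≤ K) →
    (∃ K, ∀ A, |generator rate f A| ≤ K) →
    Martingale (fun (t : ℝ≥0) ω =>
      f (X t ω) - ∫ s in (0 : ℝ)..(t : ℝ), generator rate f (X s.toNNReal ω)) F P

/-- The time `τ_A = inf {t ≥ 0 | A ⊆ X_t}`, equal to `∞` if there is no such `t`. -/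
noncomputable def hitTime {Ω : Type*} (X : ℝ≥0 → Ω → FinLower Λ) (A : Set Λ) (ω : Ω) : ℝ≥0∞ :=
  ⨅ (t : ℝ≥0) (_ : A ⊆ (X t ω).carrier), (t : ℝ≥0∞)

/-- The product `AB = {x | ∃ a ∈ A, ∃ b ∈ B, x ≤ ab}`. -/
def lowerMul [Mul Λ] (A B : Set Λ) : Set Λ := {x | ∃ a ∈ A, ∃ b ∈ B, x ≤ a * b}

/-- The powers `A ^ 0 = {1}` and `A ^ (n + 1) = A (A ^ n)` for the product above. -/
def lowerPow [Mul Λ] [One Λ] (A : Set Λ) : ℕ → Set Λ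
  | 0 => {1}
  | n + 1 => lowerMul A (lowerPow A n)

end Poset

end CrystalGrowth

set_option linter.unusedSectionVars false

/-! First-step analysis turns the probability into recursion. `meanTime` solves the first-step
equation on finite lower sets; it is bounded, and its generator is -1 until the target is filled and
0 afterwards. The martingale property then gives E[τ] = `meanTime` at the empty state
(`IsGrowthProcess.lintegral_hitTime`), so g does not depend on the realization of the process.

The three limits come from Fekete's lemma: each sequence is superadditive up to a constant and grows
at most linearly. For widths and lengths, chains are concatenated with translated chains. For times,
let b be the cell that completes A. Apart from b itself, nothing above b is filled yet, so inside
the translate bC growth restarts from a single cell. It is no faster there than in C from {1},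
because rates decrease upward and cells outside bC can only obstruct (`meanTime_add_meanTime_le`).

The bound comes from a supersolution of the first-step equation. Weight each maximal chain by c to
its length, with c = 1/(1-s). Adding a cell removes at least the fraction s of the weight of the
chains from that cell, so the logarithm of the remaining weight, divided by λ₋s, dominates
`meanTime` (`meanTime_le_log_restSum`). At the empty state this is at most (κ/s + ℓ/(1-s))/λ₋, and
optimizing over s after the limit gives the square.

Steadiness, local finiteness and linear growth rest on Dickson's lemma: two factorizations of one
element into nontrivial generators have comparable lengths (`exists_card_le_of_prod_pow_eq`). -/

namespace CrystalGrowth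

/-! ### Lengths of factorizations into generators -/

section Factorization

variable {M : Type*} [CommMonoid M] [PartialOrder M] [IsOrderedCancelMonoid M]
  [CanonicallyOrderedMul M]

/-- By cancellation, every relation between products is a sum of minimal ones, so it suffices to
compare lengths in the finitely many minimal relations. -/
theorem exists_card_le_of_prod_pow_eq {ι : Type*} [Fintype ι] (s : ι → M) (hs : ∀ i, s i ≠ 1) :
    ∃ C : ℕ, ∀ u v : ι → ℕ, ∏ i, s i ^ u i = ∏ i, s i ^ v i → ∑ i, u i ≤ C * ∑ i, v i := by
  let K : Set ((ι → ℕ) × (ι → ℕ)) := {w | w ≠ 0 ∧ ∏ i, s i ^ w.1 i = ∏ i, s i ^ w.2 i}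
  -- Dickson's lemma: an antichain of exponent vectors is finite.
  have hfin : {w | Minimal (· ∈ K) w}.Finite :=
    WellQuasiOrderedLE.finite_of_isAntichain (setOfPred_minimal_antichain _)
  obtain ⟨C, hC⟩ : ∃ C : ℕ, ∀ w ∈ {w | Minimal (· ∈ K) w}, ∑ i, w.1 i ≤ C := by
    obtain ⟨C, hC⟩ := (hfin.image fun w => ∑ i, w.1 i).bddAbove
    exact ⟨C, fun w hw => hC ⟨w, hw, rfl⟩⟩
  have hmin : ∀ w, Minimal (· ∈ K) w → ∑ i, w.1 i ≤ C * ∑ i, w.2 i := by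
    intro w hw
    -- If the second exponent vector vanished, the first product would be 1. All factors are at
    -- least 1, so the first vector would vanish too.
    refine (hC w hw).trans (Nat.le_mul_of_pos_right _ (Nat.pos_of_ne_zero fun h0 => ?_))
    have h2 : ∀ i, w.2 i = 0 := by simpa using h0
    have hp : ∏ i, s i ^ w.1 i = 1 := by rw [hw.prop.2]; simp [h2]
    have h1 : ∀ i, w.1 i = 0 := fun i => by
      by_contra hi
      have := (Finset.prod_eq_one_iff_of_one_le' (fun i _ => one_le)).1 hp i (Finset.mem_univ i)
      exact hs i (le_antisymm ((le_self_pow one_le hi).trans this.le) one_le)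
    exact hw.prop.1 (Prod.ext (funext h1) (funext h2))
  refine ⟨C, fun u v huv => ?_⟩
  induction hn : ∑ i, u i + ∑ i, v i using Nat.strong_induction_on generalizing u v with
  | _ n ih =>
    by_cases h0 : ((u, v) : (ι → ℕ) × (ι → ℕ)) = 0
    · have : u = 0 := congrArg Prod.fst h0
      simp [this]
    obtain ⟨w, hwle, hw⟩ := exists_minimal_le_of_wellFoundedLT (· ∈ K) (u, v) ⟨h0, huv⟩
    have e1 : ∀ i, u i = w.1 i + (u - w.1) i := fun i => by
      have := hwle.1 i; simp only [Pi.sub_apply]; simp only at this; omega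
    have e2 : ∀ i, v i = w.2 i + (v - w.2) i := fun i => by
      have := hwle.2 i; simp only [Pi.sub_apply]; simp only at this; omega
    have s1 : ∑ i, u i = ∑ i, w.1 i + ∑ i, (u - w.1) i := by
      rw [← Finset.sum_add_distrib]; exact Finset.sum_congr rfl fun i _ => e1 i
    have s2 : ∑ i, v i = ∑ i, w.2 i + ∑ i, (v - w.2) i := by
      rw [← Finset.sum_add_distrib]; exact Finset.sum_congr rfl fun i _ => e2 i
    have p1 : ∏ i, s i ^ u i = (∏ i, s i ^ w.1 i) * ∏ i, s i ^ (u - w.1) i := by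
      rw [← Finset.prod_mul_distrib]
      exact Finset.prod_congr rfl fun i _ => by rw [← pow_add, ← e1]
    have p2 : ∏ i, s i ^ v i = (∏ i, s i ^ w.2 i) * ∏ i, s i ^ (v - w.2) i := by
      rw [← Finset.prod_mul_distrib]
      exact Finset.prod_congr rfl fun i _ => by rw [← pow_add, ← e2]
    have hpos : 0 < ∑ i, w.1 i + ∑ i, w.2 i := by
      refine Nat.pos_of_ne_zero fun h => hw.prop.1 ?_
      have h' : (∀ i, w.1 i = 0) ∧ ∀ i, w.2 i = 0 := by simpa using h
      exact Prod.ext (funext h'.1) (funext h'.2)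
    have := ih _ (by omega) (u - w.1) (v - w.2)
      (by rw [p1, p2, hw.prop.2] at huv; exact mul_left_cancel huv) rfl
    have := hmin w hw
    rw [s1, s2, mul_add]; omega

theorem exists_card_le_of_prod_eq (S : Finset M) (h1 : (1 : M) ∉ S) :
    ∃ C : ℕ, ∀ m n : Multiset M, (∀ x ∈ m, x ∈ S) → (∀ x ∈ n, x ∈ S) → m.prod = n.prod →
      m.card ≤ C * n.card := by
  classical
  obtain ⟨C, hC⟩ := exists_card_le_of_prod_pow_eq (fun s : S => (s : M))
    fun s h => h1 (h ▸ s.2)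
  have hp : ∀ m : Multiset M, (∀ x ∈ m, x ∈ S) → m.prod = ∏ s : S, (s : M) ^ m.count (s : M) := by
    intro m hm
    rw [Finset.prod_coe_sort S fun s => s ^ m.count s, Finset.prod_multiset_count_of_subset]
    exact fun x hx => hm x (Multiset.mem_toFinset.1 hx)
  have hc : ∀ m : Multiset M, (∀ x ∈ m, x ∈ S) → m.card = ∑ s : S, m.count (s : M) := by
    intro m hm
    rw [Finset.sum_coe_sort S fun s => m.count s, Multiset.sum_count_eq_card hm]
  refine ⟨C, fun m n hm hn h => ?_⟩
  rw [hc m hm, hc n hn]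
  exact hC _ _ (by rw [← hp m hm, ← hp n hn, h])

theorem exists_multiset_prod_eq {S : Finset M} (hS : Submonoid.closure (S : Set M) = ⊤) (x : M) :
    ∃ m : Multiset M, (∀ y ∈ m, y ∈ S) ∧ m.prod = x := by
  simpa using Submonoid.exists_multiset_of_mem_closure (s := (S : Set M)) (x := x) (by simp [hS])

/-- Factor the quotient y/x: a single generator s from it already gives x < xs ≤ y, and a cover
leaves no room for xs ≠ y. -/
theorem exists_mul_eq_of_covBy {S : Finset M} (hS : Submonoid.closure (S : Set M) = ⊤)
    (h1 : (1 : M) ∉ S) {x y : M} (h : x ⋖ y) : ∃ s ∈ S, x * s = y := by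
  obtain ⟨z, rfl⟩ := exists_mul_of_le h.le
  obtain ⟨m, hm, rfl⟩ := exists_multiset_prod_eq hS z
  obtain rfl | ⟨s, hs⟩ := m.empty_or_exists_mem
  · simp at h
  obtain ⟨n, rfl⟩ := Multiset.exists_cons_of_mem hs
  refine ⟨s, hm s hs, ?_⟩
  have hs1 : 1 < s := lt_of_le_of_ne one_le fun e => h1 (e ▸ hm s hs)
  by_contra hne
  refine h.2 (lt_mul_of_one_lt_right' x hs1) (lt_of_le_of_ne ?_ hne)
  rw [Multiset.prod_cons]
  exact mul_le_mul_right (le_self_mul) x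

/-- Whatever lies below a divides a, so its factorizations extend to factorizations of a and have
bounded length; there are finitely many such words. -/
theorem locFinite_of_closure_eq_top {S : Finset M} (hS : Submonoid.closure (S : Set M) = ⊤)
    (h1 : (1 : M) ∉ S) : LocFinite M where
  finite_below a := by
    obtain ⟨C, hC⟩ := exists_card_le_of_prod_eq S h1
    obtain ⟨n, hn, rfl⟩ := exists_multiset_prod_eq hS a
    have : Finite S := inferInstance
    have hfin : {l : List S | l.length ≤ C * n.card}.Finite := List.finite_length_le S _
    refine (hfin.image fun l => (l.map (fun s : S => (s : M))).prod).subset ?_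
    intro x hx
    obtain ⟨z, hz⟩ := exists_mul_of_le hx
    obtain ⟨m, hm, rfl⟩ := exists_multiset_prod_eq hS x
    obtain ⟨k, hk, rfl⟩ := exists_multiset_prod_eq hS z
    have hcard := hC (m + k) n
      (fun y hy => (Multiset.mem_add.1 hy).elim (hm y) (hk y)) hn (by simp [hz])
    obtain ⟨l, rfl⟩ := Quot.exists_rep m
    refine ⟨l.attach.map fun y => ⟨y.1, hm _ y.2⟩, ?_, ?_⟩
    · simp at hcard ⊢; omega
    · simp [List.map_map, Function.comp_def]
  finite_minimal := (Set.finite_singleton 1).subset fun x hx =>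
    le_antisymm (hx one_le) one_le
  finite_upper a := ((S.finite_toSet).image (a * ·)).subset fun y hy => by
    obtain ⟨s, hs, h⟩ := exists_mul_eq_of_covBy hS h1 hy
    exact ⟨s, hs, h⟩

theorem exists_multiset_of_isChain_covBy {S : Finset M}
    (hS : Submonoid.closure (S : Set M) = ⊤) (h1 : (1 : M) ∉ S) :
    ∀ (l : List M) (x : M), (x :: l).IsChain (· ⋖ ·) →
      ∃ m : Multiset M, (∀ y ∈ m, y ∈ S) ∧ m.card = l.length ∧
        x * m.prod = (x :: l).getLast (List.cons_ne_nil _ _)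
  | [], x, _ => ⟨0, by simp⟩
  | y :: l, x, h => by
    rw [List.isChain_cons_cons] at h
    obtain ⟨s, hs, rfl⟩ := exists_mul_eq_of_covBy hS h1 h.1
    obtain ⟨m, hm, hc, hp⟩ := exists_multiset_of_isChain_covBy hS h1 l _ h.2
    refine ⟨s ::ₘ m, ?_, by simp [hc], ?_⟩
    · intro z hz
      rcases Multiset.mem_cons.1 hz with rfl | hz
      exacts [hs, hm z hz]
    · rw [Multiset.prod_cons, ← mul_assoc, hp, List.getLast_cons_cons]

theorem isMin_iff_eq_one {x : M} : IsMin x ↔ x = 1 :=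
  ⟨fun h => le_antisymm (h one_le) one_le, fun h => h ▸ fun _ _ => one_le⟩

/-- The length of a chain of covers from `1` to `x` is controlled by the number of generators in
any factorization of a multiple of `x`. -/
theorem exists_length_le_of_isChain_covBy {S : Finset M}
    (hS : Submonoid.closure (S : Set M) = ⊤) (h1 : (1 : M) ∉ S) :
    ∃ C : ℕ, ∀ (l : List M) (n : Multiset M), ((1 : M) :: l).IsChain (· ⋖ ·) →
      (∀ y ∈ n, y ∈ S) → ((1 : M) :: l).getLast (List.cons_ne_nil _ _) ≤ n.prod →
      l.length ≤ C * n.card := by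
  obtain ⟨C, hC⟩ := exists_card_le_of_prod_eq S h1
  refine ⟨C, fun l n hl hn hle => ?_⟩
  obtain ⟨m, hm, hc, hp⟩ := exists_multiset_of_isChain_covBy hS h1 l 1 hl
  obtain ⟨z, hz⟩ := exists_mul_of_le hle
  obtain ⟨k, hk, rfl⟩ := exists_multiset_prod_eq hS z
  have := hC (m + k) n
    (fun y hy => (Multiset.mem_add.1 hy).elim (hm y) (hk y)) hn (by rw [hz, ← hp]; simp)
  rw [Multiset.card_add] at this
  omega

end Factorization

/-! ### Powers of lower sets -/

section LowerPow

variable {M : Type*} [CommMonoid M] [PartialOrder M] [IsOrderedCancelMonoid M]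
  [CanonicallyOrderedMul M]

theorem isLowerSet_lowerPow (A : Set M) : ∀ n, IsLowerSet (lowerPow A n)
  | 0 => fun x _ hyx (hx : x = 1) => le_antisymm (hx ▸ hyx) one_le
  | _ + 1 => fun _ _ hyx ⟨a, ha, b, hb, h⟩ => ⟨a, ha, b, hb, hyx.trans h⟩

theorem finite_lowerPow (hM : LocFinite M) {A : Set M} (hA : A.Finite) :
    ∀ n, (lowerPow A n).Finite
  | 0 => Set.finite_singleton 1
  | n + 1 => by
    have : lowerPow A (n + 1) = ⋃ a ∈ A, ⋃ b ∈ lowerPow A n, Set.Iic (a * b) := by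
      ext x; simp [lowerPow, lowerMul]
    rw [this]
    exact hA.biUnion fun a _ => (finite_lowerPow hM hA n).biUnion fun b _ => hM.finite_below _

theorem one_mem_lowerPow {A : Set M} (hA : A.Nonempty) : ∀ n, (1 : M) ∈ lowerPow A n
  | 0 => rfl
  | n + 1 => ⟨_, hA.some_mem, 1, one_mem_lowerPow hA n, one_le⟩

theorem mul_mem_lowerPow_add {A : Set M} {b : M} {n : ℕ} (hb : b ∈ lowerPow A n) :
    ∀ {m : ℕ} {a : M}, a ∈ lowerPow A m → a * b ∈ lowerPow A (m + n)
  | 0, a, ha => by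
    obtain rfl : a = 1 := ha
    simpa using hb
  | m + 1, a, ⟨x, hx, y, hy, h⟩ => by
    rw [Nat.add_right_comm]
    exact ⟨x, hx, y * b, mul_mem_lowerPow_add hb hy, by
      rw [← mul_assoc]; exact mul_le_mul_left h b⟩

theorem exists_multiset_of_mem_lowerPow {S : Finset M}
    (hS : Submonoid.closure (S : Set M) = ⊤) {A : Set M} (hA : A.Finite) :
    ∃ K : ℕ, ∀ n, ∀ x ∈ lowerPow A n, ∃ m : Multiset M, (∀ y ∈ m, y ∈ S) ∧ m.card ≤ K * n ∧
      x ≤ m.prod := by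
  choose f hf hfp using exists_multiset_prod_eq hS
  obtain ⟨K, hK⟩ := (hA.image fun a => (f a).card).bddAbove
  refine ⟨K, fun n => ?_⟩
  induction n with
  | zero => exact fun x hx => ⟨0, by simp, by simp, le_of_eq (by simpa [lowerPow] using hx)⟩
  | succ n ih =>
    rintro x ⟨a, ha, b, hb, hx⟩
    obtain ⟨m, hm, hc, hp⟩ := ih b hb
    refine ⟨f a + m, fun y hy => (Multiset.mem_add.1 hy).elim (hf a y) (hm y), ?_, ?_⟩
    · have : (f a).card ≤ K := hK ⟨a, ha, rfl⟩
      rw [Multiset.card_add, Nat.mul_succ]; omega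
    · rw [Multiset.prod_add, hfp]
      exact hx.trans (mul_le_mul_right hp a)

end LowerPow

/-! ### Maximal chains and their weighted counts -/

section Chains

open scoped Classical in
/-- The upper neighbors of `x` in `A`. -/
noncomputable def covers {M : Type*} [PartialOrder M] (A : Finset M) (x : M) : Finset M :=
  A.filter (x ⋖ ·)

variable {M : Type*} [PartialOrder M]

theorem mem_covers {A : Finset M} {x y : M} : y ∈ covers A x ↔ y ∈ A ∧ x ⋖ y := by
  simp [covers]

open scoped Classical in
theorem card_filter_lt_lt {A : Finset M} {x y : M} (hy : y ∈ covers A x) :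
    (A.filter (y < ·)).card < (A.filter (x < ·)).card := by
  rw [mem_covers] at hy
  refine Finset.card_lt_card (Finset.ssubset_iff_of_subset ?_ |>.2 ⟨y, ?_, ?_⟩)
  · intro z hz
    rw [Finset.mem_filter] at hz ⊢
    exact ⟨hz.1, hy.2.lt.trans hz.2⟩
  · simp [hy.1, hy.2.lt]
  · simp

open scoped Classical in
/-- Induction along upper neighbors in a finite set. -/
theorem covers_induction (A : Finset M) {p : M → Prop}
    (h : ∀ x, (∀ y ∈ covers A x, p y) → p x) (x : M) : p x := by
  induction hn : (A.filter (x < ·)).card using Nat.strong_induction_on generalizing x with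
  | _ n ih => exact h x fun y hy => ih _ (hn ▸ card_filter_lt_lt hy) y rfl

open scoped Classical in
/-- The maximal chains of upper neighbors in `A` starting at `x`. -/
noncomputable def maxFrom (A : Finset M) (x : M) : Finset (List M) :=
  if covers A x = ∅ then {[x]} else
    (covers A x).attach.biUnion fun y => (maxFrom A y.1).image (x :: ·)
termination_by (A.filter (x < ·)).card
decreasing_by exact card_filter_lt_lt y.2

theorem maxFrom_eq_singleton {A : Finset M} {x : M} (h : covers A x = ∅) :
    maxFrom A x = {[x]} := by
  rw [maxFrom, if_pos h]

open scoped Classical in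
theorem maxFrom_eq_biUnion {A : Finset M} {x : M} (h : covers A x ≠ ∅) :
    maxFrom A x = (covers A x).biUnion fun y => (maxFrom A y).image (x :: ·) := by
  rw [maxFrom, if_neg h]
  ext l; simp

theorem mem_maxFrom {A : Finset M} {x : M} (hx : x ∈ A) {l : List M} :
    l ∈ maxFrom A x ↔ ∃ t, l = x :: t ∧ (x :: t).IsChain (· ⋖ ·) ∧ (∀ y ∈ x :: t, y ∈ A) ∧
      covers A ((x :: t).getLast (List.cons_ne_nil _ _)) = ∅ := by
  classical
  induction x using covers_induction A generalizing l with
  | h x ih =>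
    by_cases h : covers A x = ∅
    · rw [maxFrom_eq_singleton h, Finset.mem_singleton]
      refine ⟨?_, ?_⟩
      · rintro rfl
        exact ⟨[], rfl, by simp, by simpa using hx, by simpa using h⟩
      · rintro ⟨t, rfl, hc, hA, -⟩
        cases t with
        | nil => rfl
        | cons y t =>
          rw [List.isChain_cons_cons] at hc
          exact absurd (mem_covers.2 ⟨hA y (by simp), hc.1⟩) (by simp [h])
    · rw [maxFrom_eq_biUnion h]
      simp only [Finset.mem_biUnion, Finset.mem_image]
      refine ⟨?_, ?_⟩
      · rintro ⟨y, hy, l, hl, rfl⟩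
        obtain ⟨t, rfl, hc, hA, hlast⟩ := (ih y hy (mem_covers.1 hy).1).1 hl
        refine ⟨y :: t, rfl, List.isChain_cons_cons.2 ⟨(mem_covers.1 hy).2, hc⟩, ?_, ?_⟩
        · intro z hz
          rcases List.mem_cons.1 hz with rfl | hz
          exacts [hx, hA z hz]
        · rwa [List.getLast_cons_cons]
      · rintro ⟨t, rfl, hc, hA, hlast⟩
        cases t with
        | nil => exact absurd hlast h
        | cons y t =>
          rw [List.isChain_cons_cons] at hc
          have hy : y ∈ covers A x := mem_covers.2 ⟨hA y (by simp), hc.1⟩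
          refine ⟨y, hy, y :: t, (ih y hy (mem_covers.1 hy).1).2 ⟨t, rfl, hc.2, ?_, ?_⟩, rfl⟩
          · exact fun z hz => hA z (List.mem_cons_of_mem _ hz)
          · rwa [List.getLast_cons_cons] at hlast

theorem head_of_mem_maxFrom {A : Finset M} {x : M} {l : List M} (h : l ∈ maxFrom A x) :
    l.head? = some x := by
  classical
  by_cases h0 : covers A x = ∅
  · rw [maxFrom_eq_singleton h0, Finset.mem_singleton] at h; simp [h]
  · rw [maxFrom_eq_biUnion h0] at h
    simp only [Finset.mem_biUnion, Finset.mem_image] at h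
    obtain ⟨y, -, l, -, rfl⟩ := h; rfl

/-- The branches through different upper neighbors are disjoint, since the second entry of a chain
identifies its branch. -/
theorem sum_maxFrom_eq_sum_covers {A : Finset M} {x : M} (h : covers A x ≠ ∅) (f : List M → ℝ) :
    ∑ l ∈ maxFrom A x, f l = ∑ y ∈ covers A x, ∑ l ∈ maxFrom A y, f (x :: l) := by
  classical
  rw [maxFrom_eq_biUnion h, Finset.sum_biUnion]
  · exact Finset.sum_congr rfl fun y _ => Finset.sum_image fun _ _ _ _ h => (List.cons.inj h).2
  · intro y _ z _ hyz
    simp only [Function.onFun, Finset.disjoint_left, Finset.mem_image]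
    rintro _ ⟨l, hl, rfl⟩ ⟨l', hl', h⟩
    obtain rfl := (List.cons.inj h).2
    exact hyz (Option.some.inj ((head_of_mem_maxFrom hl).symm.trans (head_of_mem_maxFrom hl')))

/-- The sum of `c ^ ℓ` over the lengths `ℓ` of the maximal chains in `A` starting at `x`. -/
noncomputable def chainSum (A : Finset M) (c : ℝ) (x : M) : ℝ :=
  ∑ l ∈ maxFrom A x, c ^ l.length

theorem chainSum_of_covers_eq_empty {A : Finset M} {c : ℝ} {x : M} (h : covers A x = ∅) :
    chainSum A c x = c := by
  simp [chainSum, maxFrom_eq_singleton h]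

theorem chainSum_of_covers_ne_empty {A : Finset M} {c : ℝ} {x : M} (h : covers A x ≠ ∅) :
    chainSum A c x = c * ∑ y ∈ covers A x, chainSum A c y := by
  rw [chainSum, sum_maxFrom_eq_sum_covers h, Finset.mul_sum]
  refine Finset.sum_congr rfl fun y _ => ?_
  rw [chainSum, Finset.mul_sum]
  exact Finset.sum_congr rfl fun l _ => by rw [List.length_cons, pow_succ']

theorem le_chainSum (A : Finset M) {c : ℝ} (hc : 1 ≤ c) (x : M) : c ≤ chainSum A c x := by
  induction x using covers_induction A with
  | h x ih =>
    by_cases h : covers A x = ∅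
    · rw [chainSum_of_covers_eq_empty h]
    · rw [chainSum_of_covers_ne_empty h]
      obtain ⟨y, hy⟩ := Finset.nonempty_iff_ne_empty.2 h
      have h1 : 1 ≤ ∑ y ∈ covers A x, chainSum A c y :=
        (hc.trans (ih y hy)).trans <| Finset.single_le_sum (f := fun y => chainSum A c y)
          (fun z hz => (zero_le_one.trans hc).trans (ih z hz)) hy
      nlinarith

theorem chainSum_one (A : Finset M) (x : M) : chainSum A 1 x = (maxFrom A x).card := by
  simp [chainSum]

theorem length_le_card_of_isChain_covBy {A : Finset M} {l : List M} (h : l.IsChain (· ⋖ ·))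
    (hA : ∀ x ∈ l, x ∈ A) : l.length ≤ A.card := by
  classical
  have hlt : l.Pairwise (· < ·) :=
    List.isChain_iff_pairwise.1 (h.imp fun _ _ hxy => hxy.lt)
  have hn : l.Nodup := hlt.imp fun hxy => hxy.ne
  rw [← List.toFinset_card_of_nodup hn]
  exact Finset.card_le_card fun x hx => hA x (List.mem_toFinset.1 hx)

theorem bddAbove_length_paths (A : Finset M) : BddAbove (List.length '' paths (A : Set M)) := by
  refine ⟨A.card, ?_⟩
  rintro _ ⟨p, hp, rfl⟩
  exact length_le_card_of_isChain_covBy hp.1.2 hp.2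

theorem length_le_len {A : Finset M} {p : List M} (hp : p ∈ paths (A : Set M)) :
    p.length ≤ len (A : Set M) :=
  le_csSup (bddAbove_length_paths A) ⟨p, hp, rfl⟩

theorem exists_path_length_eq_len (A : Finset M) :
    ∃ p ∈ paths (A : Set M), p.length = len (A : Set M) := by
  have h : ([] : List M) ∈ paths (A : Set M) := ⟨⟨by simp, by simp⟩, by simp⟩
  have hl : len (A : Set M) ∈ List.length '' paths (A : Set M) :=
    Nat.sSup_mem ⟨0, ([] : List M), h, rfl⟩ (bddAbove_length_paths A)
  exact hl

theorem maxPaths_eq_maxFrom {A : Finset M} {b : M} (hb : b ∈ A) (hmin : ∀ x : M, IsMin x ↔ x = b) :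
    maxPaths (A : Set M) = maxFrom A b := by
  ext p
  rw [Finset.mem_coe, mem_maxFrom hb]
  refine ⟨?_, ?_⟩
  · rintro ⟨hp, hmax⟩
    cases p with
    | nil =>
      -- The empty path is not maximal, because it is extended by the path consisting of b alone.
      have hq : [b] ∈ paths (A : Set M) := ⟨⟨by simp [hmin], by simp⟩, by simpa using hb⟩
      exact absurd (hmax [b] hq (List.nil_prefix)) (by simp)
    | cons x t =>
      obtain rfl : x = b := (hmin x).1 (hp.1.1 x rfl)
      refine ⟨t, rfl, hp.1.2, hp.2, Finset.eq_empty_of_forall_notMem fun y hy => ?_⟩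
      rw [mem_covers] at hy
      have hq : (x :: t) ++ [y] ∈ paths (A : Set M) := by
        refine ⟨⟨by simpa using hp.1.1, ?_⟩, ?_⟩
        · refine List.isChain_append.2 ⟨hp.1.2, by simp, ?_⟩
          rw [List.getLast?_eq_some_getLast (List.cons_ne_nil x t)]
          simpa using hy.2
        · intro z hz
          rcases List.mem_append.1 hz with hz | hz
          · exact hp.2 z hz
          · obtain rfl := List.mem_singleton.1 hz
            exact hy.1
      have := congrArg List.length (hmax _ hq (List.prefix_append _ _))
      simp at this
  · rintro ⟨t, rfl, hc, hA, hlast⟩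
    refine ⟨⟨⟨by simp [hmin], hc⟩, hA⟩, ?_⟩
    rintro q hq ⟨r, rfl⟩
    cases r with
    | nil => simp
    | cons y r =>
      exfalso
      have h := (List.isChain_append.1 hq.1.2).2.2
      rw [List.getLast?_eq_some_getLast (List.cons_ne_nil b t)] at h
      have hy := h _ rfl y rfl
      have hyA : y ∈ A := hq.2 y (by simp)
      simpa [hlast] using mem_covers.2 ⟨hyA, hy⟩

end Chains

/-! ### Superadditivity of width and length -/

section ChainsMul

variable {M : Type*} [CommMonoid M] [PartialOrder M] [IsOrderedCancelMonoid M]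
  [CanonicallyOrderedMul M]

/-- Anything between two multiples of a lies above a, hence is itself a multiple of a. -/
theorem mul_covBy_mul {a x y : M} : a * x ⋖ a * y ↔ x ⋖ y := by
  refine ⟨fun h => ⟨lt_of_mul_lt_mul_left' h.1, fun z hxz hzy =>
    h.2 (mul_lt_mul_right hxz a) (mul_lt_mul_right hzy a)⟩, fun h => ⟨mul_lt_mul_right h.1 a, ?_⟩⟩
  intro z hxz hzy
  obtain ⟨w, rfl⟩ := exists_mul_of_le ((le_self_mul : a ≤ a * x).trans hxz.le)
  exact h.2 (lt_of_mul_lt_mul_left' hxz) (lt_of_mul_lt_mul_left' hzy)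

theorem maxPaths_eq {A : Finset M} (h : (1 : M) ∈ A) : maxPaths (A : Set M) = maxFrom A 1 :=
  maxPaths_eq_maxFrom h fun _ => isMin_iff_eq_one

theorem width_eq {A : Finset M} (h : (1 : M) ∈ A) :
    width (A : Set M) = Real.log (chainSum A 1 1) := by
  rw [width, maxPaths_eq h, Set.ncard_coe_finset, chainSum_one]

theorem width_nonneg (A : Set M) : 0 ≤ width A := Real.log_natCast_nonneg _

theorem chainSum_le_chainSum_mul {C Z : Finset M} {a : M} (h : ∀ x ∈ C, a * x ∈ Z) (x : M) :
    chainSum C 1 x ≤ chainSum Z 1 (a * x) := by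
  classical
  induction x using covers_induction C with
  | h x ih =>
    by_cases h0 : covers C x = ∅
    · rw [chainSum_of_covers_eq_empty h0]
      exact le_chainSum Z le_rfl _
    have hsub : (covers C x).image (a * ·) ⊆ covers Z (a * x) := by
      intro z hz
      obtain ⟨y, hy, rfl⟩ := Finset.mem_image.1 hz
      rw [mem_covers] at hy
      exact mem_covers.2 ⟨h y hy.1, mul_covBy_mul.2 hy.2⟩
    have h1 : covers Z (a * x) ≠ ∅ := by
      obtain ⟨y, hy⟩ := Finset.nonempty_iff_ne_empty.2 h0
      exact Finset.nonempty_iff_ne_empty.1 ⟨_, hsub (Finset.mem_image_of_mem _ hy)⟩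
    rw [chainSum_of_covers_ne_empty h0, chainSum_of_covers_ne_empty h1, one_mul, one_mul]
    calc ∑ y ∈ covers C x, chainSum C 1 y ≤ ∑ y ∈ covers C x, chainSum Z 1 (a * y) :=
          Finset.sum_le_sum fun y hy => ih y hy
      _ = ∑ z ∈ (covers C x).image (a * ·), chainSum Z 1 z :=
          (Finset.sum_image fun _ _ _ _ h => mul_left_cancel h).symm
      _ ≤ _ := Finset.sum_le_sum_of_subset_of_nonneg hsub fun z _ _ =>
          zero_le_one.trans (le_chainSum Z le_rfl z)

/-- At the endpoint a of a maximal chain of A, the translated chains of aC can be attached, and they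
extend to maximal chains of Z. -/
theorem chainSum_mul_chainSum_le {A C Z : Finset M} (hAZ : A ⊆ Z)
    (h : ∀ a ∈ A, ∀ x ∈ C, a * x ∈ Z) {x : M} (hx : x ∈ A) :
    chainSum A 1 x * chainSum C 1 1 ≤ chainSum Z 1 x := by
  induction x using covers_induction A with
  | h x ih =>
    by_cases h0 : covers A x = ∅
    · rw [chainSum_of_covers_eq_empty h0, one_mul]
      simpa using chainSum_le_chainSum_mul (h x hx) 1
    have hsub : covers A x ⊆ covers Z x := fun y hy => by
      rw [mem_covers] at hy ⊢
      exact ⟨hAZ hy.1, hy.2⟩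
    have h1 : covers Z x ≠ ∅ := by
      obtain ⟨y, hy⟩ := Finset.nonempty_iff_ne_empty.2 h0
      exact Finset.nonempty_iff_ne_empty.1 ⟨_, hsub hy⟩
    rw [chainSum_of_covers_ne_empty h0, chainSum_of_covers_ne_empty h1, one_mul, one_mul,
      Finset.sum_mul]
    exact (Finset.sum_le_sum fun y hy => ih y hy (mem_covers.1 hy).1).trans
      (Finset.sum_le_sum_of_subset_of_nonneg hsub fun z _ _ =>
        zero_le_one.trans (le_chainSum Z le_rfl z))

theorem width_add_width_le {A C Z : Finset M} (hA : (1 : M) ∈ A) (hC : (1 : M) ∈ C) (hAZ : A ⊆ Z)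
    (h : ∀ a ∈ A, ∀ x ∈ C, a * x ∈ Z) :
    width (A : Set M) + width (C : Set M) ≤ width (Z : Set M) := by
  have pos : ∀ B : Finset M, 0 < chainSum B 1 1 := fun B =>
    zero_lt_one.trans_le (le_chainSum B le_rfl 1)
  rw [width_eq hA, width_eq hC, width_eq (hAZ hA), ← Real.log_mul (pos A).ne' (pos C).ne']
  exact Real.log_le_log (mul_pos (pos A) (pos C)) (chainSum_mul_chainSum_le hAZ h hA)

/-- The loss of 1 occurs because the end of the first path is also the start of the translated
second path. -/
theorem len_add_len_le {A C Z : Finset M} (hA : (1 : M) ∈ A) (hAZ : A ⊆ Z)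
    (h : ∀ a ∈ A, ∀ x ∈ C, a * x ∈ Z) :
    len (A : Set M) + len (C : Set M) ≤ len (Z : Set M) + 1 := by
  obtain ⟨p, hp, hpl⟩ := exists_path_length_eq_len A
  obtain ⟨q, hq, hql⟩ := exists_path_length_eq_len C
  rw [← hpl, ← hql]
  have hone : ∀ {x}, IsMin x → x = (1 : M) := isMin_iff_eq_one.1
  have hAZl : p.length ≤ len (Z : Set M) := length_le_len ⟨hp.1, fun x hx => hAZ (hp.2 x hx)⟩
  cases q with
  | nil => simp; omega
  | cons y q =>
    obtain rfl := hone (hq.1.1 y rfl)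
    cases p with
    | nil =>
      have h1 : (1 : M) :: q ∈ paths (Z : Set M) :=
        ⟨hq.1, fun x hx => by simpa using h 1 hA x (hq.2 x hx)⟩
      have := length_le_len h1
      simp at this ⊢; omega
    | cons x p =>
      set a := (x :: p).getLast (List.cons_ne_nil x p) with ha
      have haA : a ∈ A := hp.2 _ (List.getLast_mem _)
      have hqc : ((1 :: q).map (a * ·)).IsChain (· ⋖ ·) :=
        (List.isChain_map _).2 (hq.1.2.imp fun _ _ hxy => mul_covBy_mul.2 hxy)
      rw [List.map_cons, mul_one] at hqc
      have hpath : (x :: p) ++ q.map (a * ·) ∈ paths (Z : Set M) := by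
        refine ⟨⟨by simpa using hp.1.1, List.isChain_append.2 ⟨hp.1.2, hqc.tail, ?_⟩⟩, ?_⟩
        · rw [List.getLast?_eq_some_getLast (List.cons_ne_nil x p)]
          rintro _ ⟨⟩ z hz
          cases q with
          | nil => simp at hz
          | cons w q =>
            rw [List.map_cons, List.isChain_cons_cons] at hqc
            simp only [List.map_cons, List.head?_cons, Option.mem_some_iff] at hz
            exact hz ▸ hqc.1
        · intro z hz
          rcases List.mem_append.1 hz with hz | hz
          · exact hAZ (hp.2 z hz)
          · obtain ⟨w, hw, rfl⟩ := List.mem_map.1 hz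
            exact h a haA w (hq.2 w (List.mem_cons_of_mem _ hw))
      have := length_le_len hpath
      simp at this ⊢; omega

end ChainsMul

/-! ### The first-step equation for the expected filling time -/

section MeanTime

variable {M : Type*} [PartialOrder M]

open scoped Classical in
/-- The state after an attempt to add the cell `a`: nothing changes if `a` is not available. -/
noncomputable def FinLower.grow (B : FinLower M) (a : M) : FinLower M :=
  if h : a ∈ B.growth then B.add ⟨a, h⟩ else B

theorem FinLower.grow_of_mem {B : FinLower M} {a : M} (h : a ∈ B.growth) :
    B.grow a = B.add ⟨a, h⟩ := dif_pos h

theorem FinLower.grow_of_notMem {B : FinLower M} {a : M} (h : a ∉ B.growth) :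
    B.grow a = B := dif_neg h

theorem FinLower.mem_grow {B : FinLower M} {a x : M} :
    x ∈ (B.grow a).carrier ↔ x ∈ B.carrier ∨ x = a ∧ a ∈ B.growth := by
  by_cases h : a ∈ B.growth
  · rw [FinLower.grow_of_mem h]
    simp [FinLower.add, h, or_comm]
  · simp [FinLower.grow_of_notMem h, h]

theorem FinLower.notMem_of_mem_growth {B : FinLower M} {a : M} (h : a ∈ B.growth) :
    a ∉ B.carrier := h.1

theorem FinLower.mem_growth_iff {B : FinLower M} {a : M} :
    a ∈ B.growth ↔ a ∉ B.carrier ∧ ∀ x < a, x ∈ B.carrier := by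
  refine ⟨fun h => ⟨h.1, fun x hx => ?_⟩, fun h => ⟨h.1, fun x hx hxa => ?_⟩⟩
  · by_contra hxB
    exact hx.not_ge (h.2 hxB hx.le)
  · by_contra hne
    exact hx (h.2 x (lt_of_le_not_ge hxa hne))

open scoped Classical in
/-- The cells of `C` that are available in the state `B`. -/
noncomputable def avail (C : Finset M) (B : FinLower M) : Finset M := C.filter (· ∈ B.growth)

theorem mem_avail {C : Finset M} {B : FinLower M} {a : M} :
    a ∈ avail C B ↔ a ∈ C ∧ a ∈ B.growth := by
  simp [avail]

theorem avail_nonempty {C : Finset M} (hC : IsLowerSet (C : Set M)) {B : FinLower M}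
    (h : ¬ (C : Set M) ⊆ B.carrier) : (avail C B).Nonempty := by
  classical
  obtain ⟨x, hxC, hxB⟩ := Set.not_subset.1 h
  obtain ⟨a, ha⟩ := (C.filter (· ∉ B.carrier)).exists_minimal ⟨x, by simpa using ⟨hxC, hxB⟩⟩
  have haC := Finset.mem_filter.1 ha.prop
  refine ⟨a, mem_avail.2 ⟨haC.1, haC.2, fun y hy hya => ?_⟩⟩
  exact ha.2 (Finset.mem_filter.2 ⟨hC hya haC.1, hy⟩) hya

theorem avail_eq_empty_of_subset {C : Finset M} {B : FinLower M} (h : (C : Set M) ⊆ B.carrier) :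
    avail C B = ∅ :=
  Finset.eq_empty_of_forall_notMem fun _ ha =>
    FinLower.notMem_of_mem_growth (mem_avail.1 ha).2 (h (mem_avail.1 ha).1)

open scoped Classical in
theorem card_filter_grow_lt {C : Finset M} {B : FinLower M} {a : M} (ha : a ∈ avail C B) :
    (C.filter (· ∉ (B.grow a).carrier)).card < (C.filter (· ∉ B.carrier)).card := by
  rw [mem_avail] at ha
  refine Finset.card_lt_card (Finset.ssubset_iff_of_subset ?_ |>.2 ⟨a, ?_, ?_⟩)
  · intro x hx
    rw [Finset.mem_filter, FinLower.mem_grow, not_or] at hx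
    exact Finset.mem_filter.2 ⟨hx.1, hx.2.1⟩
  · exact Finset.mem_filter.2 ⟨ha.1, ha.2.1⟩
  · simp [FinLower.mem_grow, ha.2]

open scoped Classical in
/-- Induction along the growth inside a finite set. -/
theorem grow_induction (C : Finset M) {p : FinLower M → Prop}
    (h : ∀ B, (∀ a ∈ avail C B, p (B.grow a)) → p B) (B : FinLower M) : p B := by
  induction hn : (C.filter (· ∉ B.carrier)).card using Nat.strong_induction_on generalizing B with
  | _ n ih => exact h B fun a ha => ih _ (hn ▸ card_filter_grow_lt ha) _ rfl

open scoped Classical in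
/-- The expected time to fill the finite lower set `C` from the state `B`. -/
noncomputable def meanTime (rate : M → ℝ) (C : Finset M) (B : FinLower M) : ℝ :=
  if avail C B = ∅ then 0 else
    (1 + ∑ a ∈ (avail C B).attach, rate a * meanTime rate C (B.grow a)) / ∑ a ∈ avail C B, rate a
termination_by (C.filter (· ∉ B.carrier)).card
decreasing_by exact card_filter_grow_lt a.2

variable {rate : M → ℝ} {C : Finset M}

theorem meanTime_of_subset {B : FinLower M} (h : (C : Set M) ⊆ B.carrier) :
    meanTime rate C B = 0 := by
  rw [meanTime, if_pos (avail_eq_empty_of_subset h)]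

theorem sum_avail_meanTime (hr : ∀ x, 0 < rate x) {B : FinLower M} (h : (avail C B).Nonempty) :
    ∑ a ∈ avail C B, rate a * (meanTime rate C B - meanTime rate C (B.grow a)) = 1 := by
  have hpos : 0 < ∑ a ∈ avail C B, rate a := Finset.sum_pos (fun a _ => hr a) h
  have he : meanTime rate C B = (1 + ∑ a ∈ avail C B, rate a * meanTime rate C (B.grow a)) /
      ∑ a ∈ avail C B, rate a := by
    rw [meanTime, if_neg h.ne_empty,
      Finset.sum_attach (avail C B) fun a => rate a * meanTime rate C (B.grow a)]
  rw [eq_div_iff hpos.ne'] at he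
  simp only [mul_sub, Finset.sum_sub_distrib, ← Finset.sum_mul]
  linarith

/-- Sums of increments over `C` only see the available cells. -/
theorem sum_grow_eq_sum_avail (f : FinLower M → ℝ) (B : FinLower M) :
    ∑ a ∈ C, rate a * (f B - f (B.grow a)) =
      ∑ a ∈ avail C B, rate a * (f B - f (B.grow a)) := by
  refine (Finset.sum_subset (fun a ha => (mem_avail.1 ha).1) fun a haC ha => ?_).symm
  have : a ∉ B.growth := fun h => ha (mem_avail.2 ⟨haC, h⟩)
  simp [FinLower.grow_of_notMem this]

theorem sum_grow_meanTime (hr : ∀ x, 0 < rate x) (hC : IsLowerSet (C : Set M)) {B : FinLower M}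
    (h : ¬ (C : Set M) ⊆ B.carrier) :
    ∑ a ∈ C, rate a * (meanTime rate C B - meanTime rate C (B.grow a)) = 1 := by
  rw [sum_grow_eq_sum_avail, sum_avail_meanTime hr (avail_nonempty hC h)]

/-- Comparison of the solutions of two one-step equations. -/
theorem le_of_sum_mul_sub_le {ι : Type*} {s : Finset ι} (hs : s.Nonempty) {w : ι → ℝ}
    (hw : ∀ i ∈ s, 0 < w i) {p q : ℝ} {f g : ι → ℝ} (hp : ∑ i ∈ s, w i * (p - f i) ≤ 1)
    (hq : 1 ≤ ∑ i ∈ s, w i * (q - g i)) (hfg : ∀ i ∈ s, f i ≤ g i) : p ≤ q := by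
  have hpos : 0 < ∑ i ∈ s, w i := Finset.sum_pos hw hs
  have h : ∑ i ∈ s, w i * f i ≤ ∑ i ∈ s, w i * g i :=
    Finset.sum_le_sum fun i hi => mul_le_mul_of_nonneg_left (hfg i hi) (hw i hi).le
  simp only [mul_sub, Finset.sum_sub_distrib, ← Finset.sum_mul] at hp hq
  nlinarith

theorem meanTime_nonneg (hr : ∀ x, 0 < rate x) (B : FinLower M) : 0 ≤ meanTime rate C B := by
  induction B using grow_induction C with
  | h B ih =>
    by_cases h : avail C B = ∅
    · rw [meanTime, if_pos h]
    · have h := Finset.nonempty_iff_ne_empty.2 h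
      exact le_of_sum_mul_sub_le (w := rate) (f := fun _ => 0) h (fun i _ => hr i) (by simp)
        (sum_avail_meanTime hr h).ge ih

/-- The coupling by common attempts: if the smaller state can add the cell, the larger one has it
already or can add it as well. -/
theorem grow_mono (hC : IsLowerSet (C : Set M)) {B D : FinLower M}
    (h : ∀ x ∈ C, x ∈ B.carrier → x ∈ D.carrier) {a : M} (ha : a ∈ C) :
    ∀ x ∈ C, x ∈ (B.grow a).carrier → x ∈ (D.grow a).carrier := by
  intro x hx hxB
  rw [FinLower.mem_grow] at hxB ⊢
  rcases hxB with hxB | ⟨rfl, hxB⟩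
  · exact Or.inl (h x hx hxB)
  · by_cases hxD : x ∈ D.carrier
    · exact Or.inl hxD
    · refine Or.inr ⟨rfl, FinLower.mem_growth_iff.2 ⟨hxD, fun y hy => ?_⟩⟩
      exact h y (hC hy.le ha) ((FinLower.mem_growth_iff.1 hxB).2 y hy)

-- Both first-step equations can be summed over the union of the available cells, since failed
-- attempts contribute zero. They are then compared termwise by induction on the total number of
-- missing cells.
open scoped Classical in
theorem meanTime_anti (hr : ∀ x, 0 < rate x) (hC : IsLowerSet (C : Set M)) {B D : FinLower M}
    (h : ∀ x ∈ C, x ∈ B.carrier → x ∈ D.carrier) : meanTime rate C D ≤ meanTime rate C B := by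
  induction hn : (C.filter (· ∉ B.carrier)).card + (C.filter (· ∉ D.carrier)).card
    using Nat.strong_induction_on generalizing B D with
  | _ n ih =>
    by_cases hD : (C : Set M) ⊆ D.carrier
    · rw [meanTime_of_subset hD]; exact meanTime_nonneg hr B
    have hB : ¬ (C : Set M) ⊆ B.carrier := fun hB => hD fun x hx => h x hx (hB hx)
    have hs : (avail C B ∪ avail C D).Nonempty := (avail_nonempty hC hB).inl
    have key : ∀ B' : FinLower M, avail C B' ⊆ avail C B ∪ avail C D →
        ∑ a ∈ avail C B ∪ avail C D,
          rate a * (meanTime rate C B' - meanTime rate C (B'.grow a)) =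
        ∑ a ∈ avail C B', rate a * (meanTime rate C B' - meanTime rate C (B'.grow a)) := by
      intro B' hB'
      refine (Finset.sum_subset hB' fun a ha ha' => ?_).symm
      have haC : a ∈ C := (Finset.mem_union.1 ha).elim (fun h => (mem_avail.1 h).1)
        fun h => (mem_avail.1 h).1
      have : a ∉ B'.growth := fun h => ha' (mem_avail.2 ⟨haC, h⟩)
      simp [FinLower.grow_of_notMem this]
    refine le_of_sum_mul_sub_le hs (fun i _ => hr i)
      (f := fun a => meanTime rate C (D.grow a)) (g := fun a => meanTime rate C (B.grow a))
      (by rw [key D Finset.subset_union_right, sum_avail_meanTime hr (avail_nonempty hC hD)])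
      (by rw [key B Finset.subset_union_left, sum_avail_meanTime hr (avail_nonempty hC hB)])
      fun a ha => ?_
    have haC : a ∈ C := (Finset.mem_union.1 ha).elim (fun h => (mem_avail.1 h).1)
      fun h => (mem_avail.1 h).1
    have le : ∀ B' : FinLower M, (C.filter (· ∉ (B'.grow a).carrier)).card ≤
        (C.filter (· ∉ B'.carrier)).card := fun B' => by
      by_cases h : a ∈ B'.growth
      · exact (card_filter_grow_lt (mem_avail.2 ⟨haC, h⟩)).le
      · rw [FinLower.grow_of_notMem h]
    refine ih _ ?_ (grow_mono hC h haC) rfl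
    rw [← hn]
    rcases Finset.mem_union.1 ha with ha | ha
    · exact add_lt_add_of_lt_of_le (card_filter_grow_lt ha) (le D)
    · exact add_lt_add_of_le_of_lt (le B) (card_filter_grow_lt ha)

theorem meanTime_congr (hr : ∀ x, 0 < rate x) (hC : IsLowerSet (C : Set M)) {B D : FinLower M}
    (h : ∀ x ∈ C, x ∈ B.carrier ↔ x ∈ D.carrier) : meanTime rate C B = meanTime rate C D :=
  le_antisymm (meanTime_anti hr hC fun x hx => (h x hx).2)
    (meanTime_anti hr hC fun x hx => (h x hx).1)

theorem meanTime_grow_le (hr : ∀ x, 0 < rate x) (hC : IsLowerSet (C : Set M)) (B : FinLower M)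
    (a : M) : meanTime rate C (B.grow a) ≤ meanTime rate C B :=
  meanTime_anti hr hC fun _ _ hx => FinLower.mem_grow.2 (Or.inl hx)

theorem meanTime_grow_of_notMem (hr : ∀ x, 0 < rate x) (hC : IsLowerSet (C : Set M))
    (B : FinLower M) {a : M} (ha : a ∉ C) : meanTime rate C (B.grow a) = meanTime rate C B :=
  meanTime_congr hr hC fun x hx => by
    rw [FinLower.mem_grow, or_iff_left]
    rintro ⟨rfl, -⟩
    exact ha hx

theorem meanTime_le_empty (hr : ∀ x, 0 < rate x) (hC : IsLowerSet (C : Set M)) (B : FinLower M) :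
    meanTime rate C B ≤ meanTime rate C FinLower.empty :=
  meanTime_anti hr hC fun _ _ hx => absurd hx (Set.notMem_empty _)

/-- Makes the generator a finite sum over a fixed set: unavailable cells of C contribute zero
because `grow` then does nothing. -/
theorem generator_eq_sum {f : FinLower M → ℝ} {B : FinLower M}
    (h : ∀ a ∉ C, f (B.grow a) = f B) :
    generator rate f B = ∑ a ∈ C, rate a * (f (B.grow a) - f B) := by
  classical
  have h1 : generator rate f B =
      ∑ᶠ a : B.growth, (fun x : M => rate x * (f (B.grow x) - f B)) a := by
    refine finsum_congr fun a => ?_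
    simp only [FinLower.grow_of_mem a.2]
  have h2 := finsum_mem_eq_sum_of_inter_support_eq
    (fun x : M => rate x * (f (B.grow x) - f B)) (s := B.growth) (t := avail C B) (by
      ext x
      simp only [Set.mem_inter_iff, Function.mem_support, Finset.mem_coe, mem_avail]
      refine ⟨fun hx => ⟨⟨?_, hx.1⟩, hx.2⟩, fun hx => ⟨hx.1.2, hx.2⟩⟩
      by_contra hxC
      exact hx.2 (by rw [h x hxC, sub_self, mul_zero]))
  refine h1.trans ((finsum_set_coe_eq_finsum_mem B.growth).trans (h2.trans ?_))
  refine Finset.sum_subset (fun a ha => (mem_avail.1 ha).1) fun a haC ha => ?_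
  have : a ∉ B.growth := fun h => ha (mem_avail.2 ⟨haC, h⟩)
  simp [FinLower.grow_of_notMem this]

open scoped Classical in
theorem generator_meanTime (hr : ∀ x, 0 < rate x) (hC : IsLowerSet (C : Set M)) (B : FinLower M) :
    generator rate (meanTime rate C) B = if (C : Set M) ⊆ B.carrier then 0 else -1 := by
  rw [generator_eq_sum fun a ha => meanTime_grow_of_notMem hr hC B ha]
  have hneg : ∑ a ∈ C, rate a * (meanTime rate C (B.grow a) - meanTime rate C B) =
      -∑ a ∈ C, rate a * (meanTime rate C B - meanTime rate C (B.grow a)) := by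
    rw [← Finset.sum_neg_distrib]
    exact Finset.sum_congr rfl fun a _ => by ring
  rw [hneg]
  split_ifs with h
  · rw [sum_grow_eq_sum_avail, avail_eq_empty_of_subset h]; simp
  · rw [sum_grow_meanTime hr hC h]

open scoped Classical in
/-- The indicator function of the states that contain `C`. -/
noncomputable def filled (C : Finset M) (B : FinLower M) : ℝ :=
  if (C : Set M) ⊆ B.carrier then 1 else 0

theorem filled_le_one (B : FinLower M) : filled C B ≤ 1 := by
  unfold filled; split_ifs <;> norm_num

theorem filled_nonneg (B : FinLower M) : 0 ≤ filled C B := by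
  unfold filled; split_ifs <;> norm_num

theorem filled_grow_of_notMem (B : FinLower M) {a : M} (ha : a ∉ C) :
    filled C (B.grow a) = filled C B := by
  have : (C : Set M) ⊆ (B.grow a).carrier ↔ (C : Set M) ⊆ B.carrier := by
    refine forall₂_congr fun x hx => ?_
    rw [FinLower.mem_grow, or_iff_left]
    rintro ⟨rfl, -⟩
    exact ha hx
  unfold filled
  by_cases h : (C : Set M) ⊆ B.carrier
  · rw [if_pos h, if_pos (this.2 h)]
  · rw [if_neg h, if_neg (mt this.1 h)]

theorem filled_le_grow (B : FinLower M) (a : M) : filled C B ≤ filled C (B.grow a) := by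
  unfold filled
  split_ifs with h1 h2 <;> try norm_num
  exact h2 fun x hx => FinLower.mem_grow.2 (Or.inl (h1 hx))

theorem generator_filled_nonneg (hr : ∀ x, 0 < rate x) (B : FinLower M) :
    0 ≤ generator rate (filled C) B := by
  rw [generator_eq_sum fun a ha => filled_grow_of_notMem B ha]
  exact Finset.sum_nonneg fun a _ => mul_nonneg (hr a).le (sub_nonneg.2 (filled_le_grow B a))

theorem generator_filled_le (hr : ∀ x, 0 < rate x) (B : FinLower M) :
    generator rate (filled C) B ≤ ∑ a ∈ C, rate a := by
  rw [generator_eq_sum fun a ha => filled_grow_of_notMem B ha]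
  refine Finset.sum_le_sum fun a _ => mul_le_of_le_one_right (hr a).le ?_
  linarith [filled_le_one (C := C) (B.grow a), filled_nonneg (C := C) B]

end MeanTime

/-! ### A logarithmic supersolution -/

section UpperBound

variable {M : Type*} [PartialOrder M] {rate : M → ℝ} {C : Finset M}

/-- The weighted number of maximal chains in the part of `C` that is not yet filled. -/
noncomputable def restSum (C : Finset M) (c : ℝ) (B : FinLower M) : ℝ :=
  -- For c ≥ 1 the truncation matters only when no cell is available; it keeps the logarithm
  -- nonnegative.
  max 1 (∑ a ∈ avail C B, chainSum C c a)

/-- A newly available cell was blocked by a alone. An element strictly between would already be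
filled, and then so would a. -/
theorem avail_grow_subset {B : FinLower M} {a : M} [DecidableEq M] (ha : a ∈ avail C B) :
    avail C (B.grow a) ⊆ (avail C B).erase a ∪ covers C a := by
  intro b hb
  rw [mem_avail] at ha hb
  have hbg := FinLower.mem_growth_iff.1 hb.2
  simp only [FinLower.mem_grow, ha.2, and_true, not_or] at hbg
  by_cases hab : a < b
  · refine Finset.mem_union_right _ (mem_covers.2 ⟨hb.1, hab, fun c hac hcb => ?_⟩)
    rcases hbg.2 c hcb with h | h
    · exact ha.2.1 (B.lower hac.le h)
    · exact hac.ne' h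
  · refine Finset.mem_union_left _ (Finset.mem_erase.2 ⟨hbg.1.2, mem_avail.2 ⟨hb.1, ?_⟩⟩)
    refine FinLower.mem_growth_iff.2 ⟨hbg.1.1, fun c hcb => ?_⟩
    exact (hbg.2 c hcb).resolve_right fun h => hab (h ▸ hcb)

/-- The chains from a are replaced by at most their tails, each lighter by a factor c. -/
theorem restSum_grow_le {c : ℝ} (hc : 1 ≤ c) {B : FinLower M} {a : M} (ha : a ∈ avail C B) :
    restSum C c (B.grow a) ≤ restSum C c B - chainSum C c a * (1 - c⁻¹) := by
  classical
  have hc0 : 0 < c := zero_lt_one.trans_le hc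
  have hN : ∀ x, 0 ≤ chainSum C c x := fun x => hc0.le.trans (le_chainSum C hc x)
  have h1 : chainSum C c a ≤ ∑ b ∈ avail C B, chainSum C c b :=
    Finset.single_le_sum (fun b _ => hN b) ha
  have hca : c ≤ chainSum C c a := le_chainSum C hc a
  have hW : restSum C c B = ∑ b ∈ avail C B, chainSum C c b :=
    max_eq_right (hc.trans (hca.trans h1))
  have hdiv : 1 ≤ chainSum C c a * c⁻¹ := by rwa [← div_eq_mul_inv, one_le_div hc0]
  have hcov : ∑ b ∈ covers C a, chainSum C c b ≤ chainSum C c a * c⁻¹ := by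
    by_cases h0 : covers C a = ∅
    · rw [h0, Finset.sum_empty]; exact zero_le_one.trans hdiv
    · rw [chainSum_of_covers_ne_empty h0, mul_comm c, mul_assoc, mul_inv_cancel₀ hc0.ne', mul_one]
  rw [hW]
  refine max_le (by linarith) ?_
  calc ∑ b ∈ avail C (B.grow a), chainSum C c b
      ≤ ∑ b ∈ (avail C B).erase a ∪ covers C a, chainSum C c b :=
        Finset.sum_le_sum_of_subset_of_nonneg (avail_grow_subset ha) fun x _ _ => hN x
    _ ≤ ∑ b ∈ (avail C B).erase a, chainSum C c b + ∑ b ∈ covers C a, chainSum C c b := by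
        rw [← Finset.sum_union_inter]
        exact le_add_of_nonneg_right (Finset.sum_nonneg fun x _ => hN x)
    _ ≤ _ := by
        rw [← Finset.add_sum_erase _ _ ha]
        linarith

/-- By log y ≤ y - 1, adding a lowers log W by at least s times the share of a in the total weight
W; the shares sum to 1. -/
theorem meanTime_le_log_restSum {r s : ℝ} (h0 : 0 < r) (hr : ∀ x, r ≤ rate x)
    (hs : 0 < s) (hs1 : s < 1) (B : FinLower M) :
    meanTime rate C B ≤ Real.log (restSum C (1 - s)⁻¹ B) / (r * s) := by
  have hr0 : ∀ x, 0 < rate x := fun x => h0.trans_le (hr x)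
  have hs1' : 0 < 1 - s := sub_pos.2 hs1
  have hc : 1 ≤ (1 - s)⁻¹ := (one_le_inv₀ hs1').2 (by linarith)
  have hW1 : ∀ B, 1 ≤ restSum C (1 - s)⁻¹ B := fun B => le_max_left _ _
  have hrs : 0 < r * s := mul_pos h0 hs
  induction B using grow_induction C with
  | h B ih =>
    by_cases h : avail C B = ∅
    · rw [meanTime, if_pos h]
      exact div_nonneg (Real.log_nonneg (hW1 B)) hrs.le
    have h := Finset.nonempty_iff_ne_empty.2 h
    refine le_of_sum_mul_sub_le h (fun i _ => hr0 i) (sum_avail_meanTime hr0 h).le ?_ ih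
    set W := restSum C (1 - s)⁻¹ B with hWdef
    have hWpos : 0 < W := zero_lt_one.trans_le (hW1 B)
    have hNpos : ∀ x, 0 < chainSum C (1 - s)⁻¹ x := fun x =>
      zero_lt_one.trans_le (hc.trans (le_chainSum C hc x))
    have hterm : ∀ a ∈ avail C B, chainSum C (1 - s)⁻¹ a / W ≤
        rate a * (Real.log W / (r * s) - Real.log (restSum C (1 - s)⁻¹ (B.grow a)) / (r * s)) := by
      intro a ha
      set W' := restSum C (1 - s)⁻¹ (B.grow a) with hW'
      have hW'pos : 0 < W' := zero_lt_one.trans_le (hW1 _)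
      have hle : W' ≤ W - chainSum C (1 - s)⁻¹ a * s := by
        have := restSum_grow_le hc ha
        rwa [inv_inv, sub_sub_cancel] at this
      have hlog : Real.log W' - Real.log W ≤ W' / W - 1 := by
        rw [← Real.log_div hW'pos.ne' hWpos.ne']
        exact Real.log_le_sub_one_of_pos (div_pos hW'pos hWpos)
      have hq : W' / W ≤ 1 - chainSum C (1 - s)⁻¹ a * s / W := by
        rw [div_le_iff₀ hWpos, sub_mul, div_mul_cancel₀ _ hWpos.ne']
        linarith
      have hd : chainSum C (1 - s)⁻¹ a * s / W ≤ Real.log W - Real.log W' := by linarith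
      have hd0 : 0 ≤ chainSum C (1 - s)⁻¹ a * s / W :=
        div_nonneg (mul_nonneg (hNpos a).le hs.le) hWpos.le
      rw [← sub_div]
      calc chainSum C (1 - s)⁻¹ a / W = r * ((chainSum C (1 - s)⁻¹ a * s / W) / (r * s)) := by
            field_simp
        _ ≤ r * ((Real.log W - Real.log W') / (r * s)) := by gcongr
        _ ≤ rate a * ((Real.log W - Real.log W') / (r * s)) := by
            gcongr
            · exact div_nonneg (hd0.trans hd) hrs.le
            · exact hr a
    refine le_trans ?_ (Finset.sum_le_sum hterm)
    rw [← Finset.sum_div, le_div_iff₀ hWpos, one_mul, hWdef]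
    refine max_le ?_ le_rfl
    obtain ⟨a, ha⟩ := h
    exact (hc.trans (le_chainSum C hc a)).trans
      (Finset.single_le_sum (fun b _ => (hNpos b).le) ha)

end UpperBound

/-! ### Translation and superadditivity of the mean time -/

section Shift

variable {M : Type*} [CommMonoid M] [PartialOrder M] [IsOrderedCancelMonoid M]
  [CanonicallyOrderedMul M]

/-- The set of all `x` with `a * x ∈ B`. -/
def FinLower.shift (a : M) (B : FinLower M) : FinLower M where
  carrier := {x | a * x ∈ B.carrier}
  lower := fun _ _ hyx hx => B.lower (mul_le_mul_right hyx a) hx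
  finite := B.finite.preimage fun _ _ _ _ h => mul_left_cancel h

theorem FinLower.mem_shift {a x : M} {B : FinLower M} :
    x ∈ (B.shift a).carrier ↔ a * x ∈ B.carrier := Iff.rfl

theorem one_mem_growth_empty : (1 : M) ∈ (FinLower.empty : FinLower M).growth :=
  FinLower.mem_growth_iff.2 ⟨Set.notMem_empty _, fun _ hx => absurd one_le hx.not_ge⟩

theorem FinLower.mem_grow_empty_one {x : M} :
    x ∈ ((FinLower.empty : FinLower M).grow 1).carrier ↔ x = 1 := by
  rw [FinLower.mem_grow, and_iff_left one_mem_growth_empty]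
  exact or_iff_right (Set.notMem_empty x)

theorem mem_growth_shift {a x : M} {B : FinLower M} (h : a * x ∈ B.growth) :
    x ∈ (B.shift a).growth := by
  rw [FinLower.mem_growth_iff] at h ⊢
  exact ⟨h.1, fun y hy => h.2 _ (mul_lt_mul_right hy a)⟩

theorem avail_empty {C : Finset M} (h : (1 : M) ∈ C) :
    avail C (FinLower.empty : FinLower M) = {1} := by
  ext x
  rw [mem_avail, Finset.mem_singleton]
  refine ⟨fun hx => ?_, fun hx => hx ▸ ⟨h, one_mem_growth_empty⟩⟩
  exact le_antisymm (hx.2.2 (Set.notMem_empty _) one_le) one_le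

variable {rate : M → ℝ} {A C Z : Finset M}

/-- Growth seen through the translate aC is slower than growth in C: the rate at ax is at most that
at x, and ax may also wait for cells outside aC. -/
theorem meanTime_shift_le (hr : ∀ x, 0 < rate x) (hrate : Antitone rate)
    (hC : IsLowerSet (C : Set M)) (hZ : IsLowerSet (Z : Set M)) {a : M}
    (h : ∀ x ∈ C, a * x ∈ Z) (B : FinLower M) :
    meanTime rate C (B.shift a) ≤ meanTime rate Z B := by
  classical
  induction B using grow_induction Z with
  | h B ih =>
    by_cases hZB : (Z : Set M) ⊆ B.carrier
    · rw [meanTime_of_subset hZB, meanTime_of_subset fun x hx =>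
        FinLower.mem_shift.2 (hZB (Finset.mem_coe.2 (h x hx)))]
    have hZne := avail_nonempty hZ hZB
    refine le_of_sum_mul_sub_le hZne (fun i _ => hr i) ?_ (sum_avail_meanTime hr hZne).ge ih
    rw [← sum_grow_eq_sum_avail (fun B => meanTime rate C (B.shift a))]
    have himg : C.image (a * ·) ⊆ Z := fun z hz => by
      obtain ⟨x, hx, rfl⟩ := Finset.mem_image.1 hz
      exact h x hx
    rw [← Finset.sum_subset himg fun b _ hb => ?_,
      Finset.sum_image fun _ _ _ _ h => mul_left_cancel h]
    · have hle : ∀ x ∈ C, rate (a * x) * (meanTime rate C (B.shift a) -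
          meanTime rate C ((B.grow (a * x)).shift a)) ≤
          rate x * (meanTime rate C (B.shift a) - meanTime rate C ((B.shift a).grow x)) := by
        intro x hx
        have h0 : 0 ≤ meanTime rate C (B.shift a) - meanTime rate C ((B.shift a).grow x) :=
          sub_nonneg.2 (meanTime_grow_le hr hC _ _)
        by_cases hg : a * x ∈ B.growth
        · have he : meanTime rate C ((B.grow (a * x)).shift a) =
              meanTime rate C ((B.shift a).grow x) := meanTime_congr hr hC fun y _ => by
            simp [FinLower.mem_shift, FinLower.mem_grow, hg, mem_growth_shift hg]
          rw [he]
          exact mul_le_mul_of_nonneg_right (hrate le_mul_self) h0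
        · rw [FinLower.grow_of_notMem hg, sub_self, mul_zero]
          exact mul_nonneg (hr x).le h0
      refine (Finset.sum_le_sum hle).trans ?_
      by_cases hD : (C : Set M) ⊆ (B.shift a).carrier
      · rw [sum_grow_eq_sum_avail, avail_eq_empty_of_subset hD, Finset.sum_empty]
        exact zero_le_one
      · exact (sum_grow_meanTime hr hC hD).le
    -- Adding a cell outside aC is invisible to the shifted state on C.
    · have : meanTime rate C ((B.grow b).shift a) = meanTime rate C (B.shift a) :=
        meanTime_congr hr hC fun x hx => by
          rw [FinLower.mem_shift, FinLower.mem_shift, FinLower.mem_grow, or_iff_left]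
          rintro ⟨rfl, -⟩
          exact hb (Finset.mem_image_of_mem _ hx)
      rw [this, sub_self, mul_zero]

theorem meanTime_add_meanTime_le_of_not_subset (hr : ∀ x, 0 < rate x) (hrate : Antitone rate)
    (hA : IsLowerSet (A : Set M)) (hC : IsLowerSet (C : Set M)) (hZ : IsLowerSet (Z : Set M))
    (hAZ : A ⊆ Z) (h : ∀ a ∈ A, ∀ x ∈ C, a * x ∈ Z) (B : FinLower M)
    (hB : ¬ (A : Set M) ⊆ B.carrier) :
    meanTime rate A B + meanTime rate C (FinLower.empty.grow 1) ≤ meanTime rate Z B := by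
  induction B using grow_induction Z with
  | h B ih =>
    have hZB : ¬ (Z : Set M) ⊆ B.carrier := fun h' => hB fun x hx => h' (hAZ hx)
    have hZne := avail_nonempty hZ hZB
    refine le_of_sum_mul_sub_le hZne (fun i _ => hr i)
      (f := fun b => meanTime rate A (B.grow b) + meanTime rate C (FinLower.empty.grow 1))
      ?_ (sum_avail_meanTime hr hZne).ge fun b hb => ?_
    · simp only [add_sub_add_right_eq_sub]
      rw [← sum_grow_eq_sum_avail, ← Finset.sum_subset hAZ fun b _ hb => by
        rw [meanTime_grow_of_notMem hr hA B hb, sub_self, mul_zero]]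
      exact (sum_grow_meanTime hr hA hB).le
    -- If b completes A, no bx lay in B, since b itself did not. The new state shifted by b is
    -- therefore exactly {1}.
    · by_cases hBb : (A : Set M) ⊆ (B.grow b).carrier
      · have hbg := (mem_avail.1 hb).2
        have hbA : b ∈ A := by
          by_contra hbA
          refine hB fun x hx => (FinLower.mem_grow.1 (hBb hx)).resolve_right ?_
          rintro ⟨rfl, -⟩
          exact hbA hx
        rw [meanTime_of_subset hBb, zero_add]
        refine le_trans (le_of_eq (meanTime_congr hr hC fun x _ => ?_))
          (meanTime_shift_le hr hrate hC hZ (h b hbA) (B.grow b))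
        rw [FinLower.mem_grow_empty_one, FinLower.mem_shift, FinLower.mem_grow,
          and_iff_left hbg, mul_eq_left, or_iff_right]
        exact fun hx => hbg.1 (B.lower le_self_mul hx)
      · exact ih b hb hBb

/-- The correction is the mean waiting time for the cell 1, which the second growth finds already
filled. -/
theorem meanTime_add_meanTime_le (hr : ∀ x, 0 < rate x) (hrate : Antitone rate)
    (hA : IsLowerSet (A : Set M)) (hC : IsLowerSet (C : Set M)) (hZ : IsLowerSet (Z : Set M))
    (h1A : 1 ∈ A) (h1C : 1 ∈ C) (hAZ : A ⊆ Z) (h : ∀ a ∈ A, ∀ x ∈ C, a * x ∈ Z) :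
    meanTime rate A FinLower.empty + meanTime rate C FinLower.empty ≤
      meanTime rate Z FinLower.empty + (rate 1)⁻¹ := by
  have hne : ∀ {D : Finset M}, (1 : M) ∈ D →
      ¬ (D : Set M) ⊆ (FinLower.empty : FinLower M).carrier := fun hD h =>
    Set.notMem_empty _ (h hD)
  have h1 := meanTime_add_meanTime_le_of_not_subset hr hrate hA hC hZ hAZ h FinLower.empty
    (hne h1A)
  have h2 := sum_avail_meanTime hr (avail_nonempty hC (hne h1C))
  rw [avail_empty h1C, Finset.sum_singleton] at h2
  have h3 : meanTime rate C FinLower.empty - meanTime rate C (FinLower.empty.grow 1) =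
      (rate 1)⁻¹ := eq_inv_of_mul_eq_one_right h2
  linarith

end Shift

/-! ### Optimization over s and Fekete's lemma -/

section Bound

variable {M : Type*} [CommMonoid M] [PartialOrder M] [IsOrderedCancelMonoid M]
  [CanonicallyOrderedMul M] {rate : M → ℝ} {C : Finset M}

/-- At the empty state the weight is at most the number of maximal chains times c to the maximal
length, and log c = -log(1-s) ≤ s/(1-s). -/
theorem meanTime_le_width_add_len {r s : ℝ} (h0 : 0 < r) (hr : ∀ x, r ≤ rate x)
    (hs : 0 < s) (hs1 : s < 1) (h1 : (1 : M) ∈ C) :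
    meanTime rate C FinLower.empty ≤
      1 / r * (width (C : Set M) / s + len (C : Set M) / (1 - s)) := by
  have hs1' : 0 < 1 - s := sub_pos.2 hs1
  have hc : 1 ≤ (1 - s)⁻¹ := (one_le_inv₀ hs1').2 (by linarith)
  refine (meanTime_le_log_restSum h0 hr hs hs1 _).trans ?_
  have hN : 0 < chainSum C (1 - s)⁻¹ 1 := zero_lt_one.trans_le (hc.trans (le_chainSum C hc 1))
  have hW : restSum C (1 - s)⁻¹ FinLower.empty = chainSum C (1 - s)⁻¹ 1 := by
    rw [restSum, avail_empty h1, Finset.sum_singleton, max_eq_right (hc.trans (le_chainSum C hc 1))]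
  have hle : chainSum C (1 - s)⁻¹ 1 ≤ chainSum C 1 1 * (1 - s)⁻¹ ^ len (C : Set M) := by
    rw [chainSum, chainSum_one, ← nsmul_eq_mul]
    refine Finset.sum_le_card_nsmul _ _ _ fun l hl => pow_le_pow_right₀ hc (length_le_len ?_)
    have : l ∈ maxPaths (C : Set M) := by rw [maxPaths_eq h1]; exact hl
    exact this.1
  have hlog : Real.log (chainSum C (1 - s)⁻¹ 1) ≤
      width (C : Set M) + len (C : Set M) * (s / (1 - s)) := by
    refine (Real.log_le_log hN hle).trans ?_
    rw [Real.log_mul (zero_lt_one.trans_le (le_chainSum C le_rfl 1)).ne'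
      (pow_pos (zero_lt_one.trans_le hc) _).ne', ← width_eq h1, Real.log_pow]
    have h2 : Real.log (1 - s)⁻¹ ≤ s / (1 - s) := by
      refine (Real.log_le_sub_one_of_pos (inv_pos.2 hs1')).trans (le_of_eq ?_)
      field_simp
      ring
    gcongr
  rw [hW]
  calc Real.log (chainSum C (1 - s)⁻¹ 1) / (r * s)
      ≤ (width (C : Set M) + len (C : Set M) * (s / (1 - s))) / (r * s) := by gcongr
    _ = _ := by field_simp

theorem le_sq_sqrt_add_sqrt {x k l : ℝ} (hk : 0 ≤ k) (hl : 0 ≤ l)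
    (h : ∀ s, 0 < s → s < 1 → x ≤ k / s + l / (1 - s)) : x ≤ (√k + √l) ^ 2 := by
  -- The optimum is s = √k/(√k + √l). The perturbation by ε keeps s strictly inside (0,1) even when
  -- k or l vanishes.
  have hb : ∀ ε : ℝ, 0 < ε → x ≤ (√k + √l) * (√k + √l + 2 * ε) := by
    intro ε hε
    have h1 : 0 ≤ √k := Real.sqrt_nonneg k
    have h2 : 0 ≤ √l := Real.sqrt_nonneg l
    have h3 : 0 < √k + ε := by linarith
    have h4 : 0 < √l + ε := by linarith
    have hT : 0 < √k + √l + 2 * ε := by linarith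
    have hs : 1 - (√k + ε) / (√k + √l + 2 * ε) = (√l + ε) / (√k + √l + 2 * ε) := by
      field_simp; ring
    have := h ((√k + ε) / (√k + √l + 2 * ε)) (by positivity)
      ((div_lt_one hT).2 (by linarith))
    rw [hs] at this
    have e : ∀ y : ℝ, 0 ≤ y →
        y / ((√y + ε) / (√k + √l + 2 * ε)) ≤ √y * (√k + √l + 2 * ε) := by
      intro y hy
      have hy0 := Real.sqrt_nonneg y
      have hy1 : 0 < √y + ε := by linarith
      rw [div_div_eq_mul_div, div_le_iff₀ hy1]
      have hyy := Real.mul_self_sqrt hy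
      calc y * (√k + √l + 2 * ε) = √y * √y * (√k + √l + 2 * ε) := by rw [hyy]
        _ ≤ √y * (√y + ε) * (√k + √l + 2 * ε) := by gcongr; linarith
        _ = _ := by ring
    linarith [e k hk, e l hl]
  have ht : Tendsto (fun ε : ℝ => (√k + √l) * (√k + √l + 2 * ε)) (𝓝[>] 0)
      (𝓝 ((√k + √l) * (√k + √l + 2 * 0))) :=
    (Continuous.tendsto (by fun_prop) 0).mono_left nhdsWithin_le_nhds
  rw [mul_zero, add_zero, ← sq] at ht
  exact ge_of_tendsto ht (eventually_mem_nhdsWithin.mono fun ε hε => hb ε hε)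

/-- Fekete's lemma for sequences that are superadditive up to a constant. -/
theorem exists_tendsto_div_of_superadditive {u : ℕ → ℝ} {c K : ℝ}
    (h : ∀ m n, u m + u n ≤ u (m + n) + c) (hK : ∀ n : ℕ, 0 < n → u n ≤ K * n) :
    ∃ l, Tendsto (fun n : ℕ => u n / n) atTop (𝓝 l) := by
  have hv : Subadditive fun n => c - u n := fun m n => by
    show c - u (m + n) ≤ c - u m + (c - u n)
    linarith [h m n]
  have hbdd : BddBelow (Set.range fun n : ℕ => (c - u n) / n) := by
    refine ⟨-|c| - |K|, ?_⟩
    rintro _ ⟨n, rfl⟩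
    rcases Nat.eq_zero_or_pos n with rfl | hn
    · simp only [Nat.cast_zero, div_zero]
      linarith [abs_nonneg c, abs_nonneg K]
    · have hn' : (1 : ℝ) ≤ n := by exact_mod_cast hn
      show -|c| - |K| ≤ (c - u n) / n
      rw [le_div_iff₀ (by linarith)]
      have h1 := hK n hn
      have h2 : K * n ≤ |K| * n := mul_le_mul_of_nonneg_right (le_abs_self K) (by linarith)
      nlinarith [neg_abs_le c, abs_nonneg c]
  have h0 : Tendsto (fun n : ℕ => c / (n : ℝ)) atTop (𝓝 0) :=
    tendsto_const_div_atTop_nhds_zero_nat c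
  refine ⟨0 - hv.lim, (h0.sub (hv.tendsto_lim hbdd)).congr fun n => ?_⟩
  rw [← sub_div, sub_sub_cancel]

end Bound

/-! ### From the martingale problem to the expected hitting time -/

section Trajectories

variable {M : Type*} [PartialOrder M] {rate : M → ℝ} {C : Finset M}
  {Ω : Type*} {m : MeasurableSpace Ω} {P : Measure Ω} {F : Filtration ℝ≥0 m}
  {X : ℝ≥0 → Ω → FinLower M}

/-- The path is the pointwise limit of its values at grid points strictly to the right of t, with
mesh tending to 0. -/
theorem measurable_of_eventually_eq_nhdsGT {x : ℝ≥0 → ℝ}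
    (hx : ∀ t, ∀ᶠ s in 𝓝[>] t, x s = x t) : Measurable x := by
  let a : ℕ → ℝ≥0 → ℝ≥0 := fun n t => ((⌊t * (n + 1)⌋₊ : ℝ≥0) + 1) / (n + 1)
  have ha : ∀ n, Measurable fun t => x (a n t) := fun n => by
    have h1 : Measurable fun t : ℝ≥0 => ⌊t * ((n : ℝ≥0) + 1)⌋₊ :=
      Nat.measurable_floor.comp (measurable_id.mul_const _)
    exact (measurable_from_top (f := fun k : ℕ => x (((k : ℝ≥0) + 1) / (n + 1)))).comp h1
  refine measurable_of_tendsto_metrizable ha (tendsto_pi_nhds.2 fun t => ?_)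
  have hgt : ∀ n, t < a n t := fun n => by
    show t < ((⌊t * ((n : ℝ≥0) + 1)⌋₊ : ℝ≥0) + 1) / (n + 1)
    rw [lt_div_iff₀ (by positivity)]
    exact Nat.lt_floor_add_one _
  have hle : ∀ n, a n t ≤ t + 1 / ((n : ℝ≥0) + 1) := fun n => by
    show ((⌊t * ((n : ℝ≥0) + 1)⌋₊ : ℝ≥0) + 1) / (n + 1) ≤ _
    rw [add_div]
    gcongr
    rw [div_le_iff₀ (by positivity)]
    exact Nat.floor_le zero_le
  have hlim : Tendsto (fun n => a n t) atTop (𝓝[>] t) := by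
    refine tendsto_nhdsWithin_iff.2 ⟨?_, Eventually.of_forall fun n => hgt n⟩
    refine tendsto_of_tendsto_of_tendsto_of_le_of_le tendsto_const_nhds ?_
      (fun n => (hgt n).le) hle
    have : Tendsto (fun n : ℕ => t + 1 / ((n : ℝ≥0) + 1)) atTop (𝓝 (t + 0)) :=
      tendsto_const_nhds.add tendsto_one_div_add_atTop_nhds_zero_nat
    rwa [add_zero] at this
  exact tendsto_const_nhds.congr' ((hlim.eventually (hx t)).mono fun n hn => hn.symm)

theorem IsGrowthProcess.measurable_path (hX : IsGrowthProcess rate P F X) (f : FinLower M → ℝ)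
    (ω : Ω) : Measurable fun s : ℝ => f (X s.toNNReal ω) :=
  (measurable_of_eventually_eq_nhdsGT (x := fun t => f (X t ω)) fun t =>
    (hX.right_cont ω t).mono fun _ hs => congrArg f hs).comp measurable_real_toNNReal

theorem IsGrowthProcess.intervalIntegrable (hX : IsGrowthProcess rate P F X)
    {f : FinLower M → ℝ} {K : ℝ} (hf : ∀ B, |f B| ≤ K) (ω : Ω) (a b : ℝ) :
    IntervalIntegrable (fun s : ℝ => f (X s.toNNReal ω)) volume a b :=
  (intervalIntegrable_const (c := K)).mono_fun (hX.measurable_path f ω).aestronglyMeasurable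
    (Eventually.of_forall fun _ => (hf _).trans (le_abs_self K))

theorem IsGrowthProcess.measurable (hX : IsGrowthProcess rate P F X) (f : FinLower M → ℝ)
    (t : ℝ≥0) : Measurable fun ω => f (X t ω) := fun U _ =>
  F.le t _ (hX.adapted t (f ⁻¹' U))

theorem IsGrowthProcess.exists_rat_btwn (hX : IsGrowthProcess rate P F X) (ω : Ω) {t b : ℝ≥0}
    (h : t < b) : ∃ q : ℚ, t < (q : ℝ).toNNReal ∧ (q : ℝ).toNNReal < b ∧
      X (q : ℝ).toNNReal ω = X t ω := by
  obtain ⟨u, hu, hsub⟩ := mem_nhdsGT_iff_exists_Ioo_subset.1 (hX.right_cont ω t)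
  obtain ⟨q, -, h1, h2⟩ := (NNReal.lt_iff_exists_rat_btwn t (min u b)).1 (lt_min hu h)
  exact ⟨q, h1, h2.trans_le (min_le_right _ _), hsub ⟨h1, h2.trans_le (min_le_left _ _)⟩⟩

theorem filled_eq_one_iff {B : FinLower M} : filled C B = 1 ↔ (C : Set M) ⊆ B.carrier := by
  unfold filled; split_ifs with h <;> simp [h]

/-- Monotonicity of trajectories is not part of the definition. On the event that C is filled at
time s, the indicator is at its maximum and its compensator is nondecreasing, so the martingale can
only decrease; having mean-zero increments there, it is a.s. unchanged. -/
theorem IsGrowthProcess.subset_ae_of_le [IsProbabilityMeasure P]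
    (hX : IsGrowthProcess rate P F X) (hr : ∀ x, 0 < rate x) {s t : ℝ≥0} (hst : s ≤ t) :
    ∀ᵐ ω ∂P, (C : Set M) ⊆ (X s ω).carrier → (C : Set M) ⊆ (X t ω).carrier := by
  have hgb : ∀ B, |generator rate (filled C) B| ≤ ∑ a ∈ C, rate a := fun B => by
    rw [abs_of_nonneg (generator_filled_nonneg hr B)]; exact generator_filled_le hr B
  have hM := hX.martingale (filled C) ⟨1, fun B => by
    rw [abs_of_nonneg (filled_nonneg B)]; exact filled_le_one B⟩ ⟨_, hgb⟩
  set N : ℝ≥0 → Ω → ℝ := fun t ω =>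
    filled C (X t ω) - ∫ r in (0 : ℝ)..(t : ℝ), generator rate (filled C) (X r.toNNReal ω) with hN
  set E : Set Ω := X s ⁻¹' {B | (C : Set M) ⊆ B.carrier} with hE
  have hEs : MeasurableSet[F s] E := hX.adapted s _
  have hEm : MeasurableSet E := F.le s _ hEs
  have hint := hM.setIntegral_eq hst hEs
  have hI : ∀ ω, 0 ≤ (∫ r in (0 : ℝ)..(t : ℝ), generator rate (filled C) (X r.toNNReal ω)) -
      ∫ r in (0 : ℝ)..(s : ℝ), generator rate (filled C) (X r.toNNReal ω) := fun ω => by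
    rw [intervalIntegral.integral_interval_sub_left (hX.intervalIntegrable hgb ω _ _)
      (hX.intervalIntegrable hgb ω _ _)]
    exact intervalIntegral.integral_nonneg (by exact_mod_cast hst) fun r _ =>
      generator_filled_nonneg hr _
  have hpos : ∀ ω ∈ E, 1 - filled C (X t ω) ≤ N s ω - N t ω := fun ω hω => by
    have h1 : filled C (X s ω) = 1 := filled_eq_one_iff.2 hω
    have := hI ω
    simp only [hN, h1]
    linarith
  have h0 : ∫ ω in E, (N s ω - N t ω) ∂P = 0 := by
    rw [integral_sub (hM.integrable s).integrableOn (hM.integrable t).integrableOn]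
    exact sub_eq_zero.2 hint
  have hnn : 0 ≤ᵐ[P.restrict E] fun ω => N s ω - N t ω :=
    (ae_restrict_iff' hEm).2 (Eventually.of_forall fun ω hω =>
      (sub_nonneg.2 (filled_le_one _)).trans (hpos ω hω))
  have hz := (setIntegral_eq_zero_iff_of_nonneg_ae hnn
    ((hM.integrable s).sub (hM.integrable t)).integrableOn).1 h0
  filter_upwards [(ae_restrict_iff' hEm).1 hz] with ω hω hs
  have h1 : N s ω - N t ω = 0 := hω hs
  have h2 := hpos ω hs
  exact filled_eq_one_iff.1 (le_antisymm (filled_le_one _) (by linarith))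

theorem IsGrowthProcess.subset_mono_ae [IsProbabilityMeasure P]
    (hX : IsGrowthProcess rate P F X) (hr : ∀ x, 0 < rate x) :
    ∀ᵐ ω ∂P, ∀ s t : ℝ≥0, s ≤ t → (C : Set M) ⊆ (X s ω).carrier →
      (C : Set M) ⊆ (X t ω).carrier := by
  have h : ∀ᵐ ω ∂P, ∀ p q : ℚ, (p : ℝ).toNNReal ≤ (q : ℝ).toNNReal →
      (C : Set M) ⊆ (X (p : ℝ).toNNReal ω).carrier →
      (C : Set M) ⊆ (X (q : ℝ).toNNReal ω).carrier := by
    refine ae_all_iff.2 fun p => ae_all_iff.2 fun q => ?_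
    by_cases hpq : (p : ℝ).toNNReal ≤ (q : ℝ).toNNReal
    · exact (hX.subset_ae_of_le hr hpq).mono fun ω hω _ => hω
    · exact Eventually.of_forall fun ω h => absurd h hpq
  filter_upwards [h] with ω hω s t hst hs
  rcases hst.eq_or_lt with rfl | hst
  · exact hs
  obtain ⟨p, -, hp, hps⟩ := hX.exists_rat_btwn ω hst
  obtain ⟨q, hq, -, hqt⟩ := hX.exists_rat_btwn ω (lt_add_one t)
  rw [← hqt]
  exact hω p q (hp.trans hq).le (hps ▸ hs)

theorem hitTime_le {A : Set M} {t : ℝ≥0} {ω : Ω} (h : A ⊆ (X t ω).carrier) :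
    hitTime X A ω ≤ t := by
  unfold hitTime
  exact iInf₂_le t h

open scoped Classical in
theorem IsGrowthProcess.measurable_hitTime (hX : IsGrowthProcess rate P F X) (A : Set M) :
    Measurable (hitTime X A) := by
  have he : hitTime X A = fun ω => ⨅ q : ℚ,
      if A ⊆ (X (q : ℝ).toNNReal ω).carrier then (((q : ℝ).toNNReal : ℝ≥0) : ℝ≥0∞) else ∞ := by
    ext ω
    refine le_antisymm (le_iInf fun q => ?_) (le_iInf₂ fun t ht => ?_)
    · split_ifs with h
      · exact hitTime_le h
      · exact le_top
    · refine ENNReal.le_of_forall_pos_le_add fun ε hε _ => ?_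
      obtain ⟨q, -, hq, hqt⟩ := hX.exists_rat_btwn ω (lt_add_of_pos_right t hε)
      refine (iInf_le _ q).trans ?_
      rw [if_pos (hqt ▸ ht)]
      exact_mod_cast hq.le
  rw [he]
  refine Measurable.iInf fun q => Measurable.ite ?_ measurable_const measurable_const
  exact F.le _ _ (hX.adapted (q : ℝ).toNNReal {B | A ⊆ B.carrier})

-- The integrand is -1 before the hitting time and 0 after it; its value at that instant is
-- irrelevant, a null set.
open scoped Classical in
theorem integral_eq_neg_min_hitTime {ω : Ω}
    (hω : ∀ s t : ℝ≥0, s ≤ t → (C : Set M) ⊆ (X s ω).carrier → (C : Set M) ⊆ (X t ω).carrier)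
    (t : ℝ≥0) :
    ∫ s in (0 : ℝ)..(t : ℝ), (if (C : Set M) ⊆ (X s.toNNReal ω).carrier then (0 : ℝ) else -1) =
      -(min (hitTime X C ω) t).toReal := by
  set T := (min (hitTime X C ω) t).toReal with hT
  have hTtop : min (hitTime X C ω) (t : ℝ≥0∞) ≠ ∞ := ((min_le_right _ _).trans_lt
    ENNReal.coe_lt_top).ne
  have hTt : T ≤ t := ENNReal.toReal_le_coe_of_le_coe (min_le_right _ _)
  have hT0 : 0 ≤ T := ENNReal.toReal_nonneg
  have hlt : ∀ s : ℝ, 0 ≤ s → s < T → ¬ (C : Set M) ⊆ (X s.toNNReal ω).carrier := by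
    intro s hs0 hs h
    have h1 : hitTime X C ω ≤ (s.toNNReal : ℝ≥0∞) := hitTime_le h
    have h2 : T ≤ s := by
      have := ENNReal.toReal_mono ENNReal.coe_ne_top ((min_le_left _ (t : ℝ≥0∞)).trans h1)
      rwa [ENNReal.coe_toReal, Real.coe_toNNReal s hs0] at this
    exact absurd hs h2.not_gt
  have hgt : ∀ s : ℝ, T < s → s ≤ t → (C : Set M) ⊆ (X s.toNNReal ω).carrier := by
    intro s hs hst
    have hs0 : 0 ≤ s := hT0.trans hs.le
    have h1 : min (hitTime X C ω) (t : ℝ≥0∞) < (s.toNNReal : ℝ≥0∞) := by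
      rw [← ENNReal.toReal_lt_toReal hTtop ENNReal.coe_ne_top, ENNReal.coe_toReal,
        Real.coe_toNNReal s hs0]
      exact hs
    have h2 : (s.toNNReal : ℝ≥0∞) ≤ t := by
      exact_mod_cast Real.toNNReal_le_iff_le_coe.2 hst
    have h3 : hitTime X C ω < (s.toNNReal : ℝ≥0∞) :=
      (min_lt_iff.1 h1).resolve_right h2.not_gt
    obtain ⟨r, hr⟩ := iInf_lt_iff.1 h3
    obtain ⟨hr, hrs⟩ := iInf_lt_iff.1 hr
    exact hω r _ (by exact_mod_cast hrs.le) hr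
  have hne : ∀ᵐ s : ℝ, s ≠ T := by simp [ae_iff]
  rw [intervalIntegral.integral_congr_ae
    (g := {s : ℝ | s ≤ T}.indicator fun _ => (-1 : ℝ)),
    intervalIntegral.integral_indicator ⟨hT0, hTt⟩]
  · simp
  · filter_upwards [hne] with s hs hst
    rw [Set.uIoc_of_le t.coe_nonneg] at hst
    rcases lt_or_gt_of_ne hs with h | h
    · rw [if_neg (hlt s hst.1.le h), Set.indicator_of_mem (show s ∈ {s : ℝ | s ≤ T} from h.le)]
    · rw [if_pos (hgt s h hst.2),
        Set.indicator_of_notMem (show s ∉ {s : ℝ | s ≤ T} from h.not_ge)]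

/-- Equate the expectations at times 0 and t of the martingale attached to `meanTime`. -/
theorem IsGrowthProcess.lintegral_min_hitTime [IsProbabilityMeasure P]
    (hX : IsGrowthProcess rate P F X) (hr : ∀ x, 0 < rate x) (hC : IsLowerSet (C : Set M))
    (t : ℝ≥0) :
    ∫⁻ ω, min (hitTime X C ω) t ∂P = ENNReal.ofReal
      (meanTime rate C FinLower.empty - ∫ ω, meanTime rate C (X t ω) ∂P) := by
  classical
  have hub : ∀ B, |meanTime rate C B| ≤ meanTime rate C FinLower.empty := fun B => by
    rw [abs_of_nonneg (meanTime_nonneg hr B)]; exact meanTime_le_empty hr hC B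
  have hM := hX.martingale (meanTime rate C) ⟨_, hub⟩ ⟨1, fun B => by
    rw [generator_meanTime hr hC]; split_ifs <;> simp⟩
  have hu : Integrable (fun ω => meanTime rate C (X t ω)) P :=
    .of_bound (hX.measurable _ t).aestronglyMeasurable _ (Eventually.of_forall fun ω => hub _)
  have hmin : ∀ ω, min (hitTime X C ω) (t : ℝ≥0∞) ≠ ∞ := fun ω =>
    ((min_le_right _ _).trans_lt ENNReal.coe_lt_top).ne
  have hint : Integrable (fun ω => (min (hitTime X C ω) (t : ℝ≥0∞)).toReal) P := by
    refine .of_bound (((hX.measurable_hitTime C).min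
      measurable_const).ennreal_toReal).aestronglyMeasurable (t : ℝ)
      (Eventually.of_forall fun ω => ?_)
    rw [Real.norm_of_nonneg ENNReal.toReal_nonneg]
    exact ENNReal.toReal_le_coe_of_le_coe (min_le_right _ _)
  have h1 := hM.setIntegral_eq (zero_le : (0 : ℝ≥0) ≤ t) MeasurableSet.univ
  simp only [Measure.restrict_univ, NNReal.coe_zero, intervalIntegral.integral_same, sub_zero,
    hX.start, integral_const, probReal_univ, one_smul] at h1
  have h2 : ∫ ω, (meanTime rate C (X t ω) - ∫ s in (0 : ℝ)..(t : ℝ),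
      generator rate (meanTime rate C) (X s.toNNReal ω)) ∂P =
      ∫ ω, (meanTime rate C (X t ω) + (min (hitTime X C ω) (t : ℝ≥0∞)).toReal) ∂P := by
    refine integral_congr_ae ?_
    filter_upwards [hX.subset_mono_ae (C := C) hr] with ω hω
    simp only [generator_meanTime hr hC]
    rw [integral_eq_neg_min_hitTime hω, sub_neg_eq_add]
  rw [h2, integral_add hu hint] at h1
  rw [h1, add_sub_cancel_left, ofReal_integral_eq_lintegral_ofReal hint
    (Eventually.of_forall fun ω => ENNReal.toReal_nonneg)]
  exact lintegral_congr fun ω => (ENNReal.ofReal_toReal (hmin ω)).symm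

theorem IsGrowthProcess.lintegral_hitTime [IsProbabilityMeasure P]
    (hX : IsGrowthProcess rate P F X) (hr : ∀ x, 0 < rate x) (hC : IsLowerSet (C : Set M)) :
    ∫⁻ ω, hitTime X C ω ∂P = ENNReal.ofReal (meanTime rate C FinLower.empty) := by
  have hτ := hX.measurable_hitTime (C : Set M)
  have hlim : ∀ x : ℝ≥0∞, Tendsto (fun n : ℕ => min x ((n : ℝ≥0) : ℝ≥0∞)) atTop (𝓝 x) := by
    intro x
    have h := (tendsto_const_nhds (x := x)).min ENNReal.tendsto_nat_nhds_top
    rw [min_eq_left le_top] at h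
    exact h.congr fun n => by simp
  have hmono : Tendsto (fun n : ℕ => ∫⁻ ω, min (hitTime X C ω) ((n : ℝ≥0) : ℝ≥0∞) ∂P) atTop
      (𝓝 (∫⁻ ω, hitTime X C ω ∂P)) := by
    refine lintegral_tendsto_of_tendsto_of_monotone
      (fun n => (hτ.min measurable_const).aemeasurable)
      (Eventually.of_forall fun ω i j hij => min_le_min_left _ ?_)
      (Eventually.of_forall fun ω => hlim _)
    exact_mod_cast hij
  simp only [hX.lintegral_min_hitTime hr hC] at hmono
  -- Finiteness must come first: it makes the hitting time a.s. finite, so that `meanTime` along the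
  -- path eventually vanishes and dominated convergence removes the remainder.
  have hfin : ∫⁻ ω, hitTime X C ω ∂P ≠ ∞ := by
    refine ((le_of_tendsto' hmono fun n => ENNReal.ofReal_le_ofReal ?_).trans_lt
      (ENNReal.ofReal_lt_top (r := meanTime rate C FinLower.empty))).ne
    exact sub_le_self _ (integral_nonneg fun ω => meanTime_nonneg hr _)
  have hzero : Tendsto (fun n : ℕ => ∫ ω, meanTime rate C (X n ω) ∂P) atTop (𝓝 (∫ _, 0 ∂P)) := by
    refine tendsto_integral_of_dominated_convergence
      (fun _ => meanTime rate C FinLower.empty)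
      (fun n => (hX.measurable _ _).aestronglyMeasurable) (integrable_const _)
      (fun n => Eventually.of_forall fun ω => ?_) ?_
    · rw [Real.norm_of_nonneg (meanTime_nonneg hr _)]
      exact meanTime_le_empty hr hC _
    · filter_upwards [hX.subset_mono_ae (C := C) hr, ae_lt_top hτ hfin] with ω hω hlt
      obtain ⟨s, hs⟩ := iInf_lt_iff.1 hlt
      obtain ⟨hs, -⟩ := iInf_lt_iff.1 hs
      obtain ⟨n, hn⟩ := exists_nat_ge s
      refine tendsto_const_nhds.congr' ((eventually_ge_atTop n).mono fun k hk => ?_)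
      refine (meanTime_of_subset (hω s k (hn.trans ?_) hs)).symm
      exact_mod_cast hk
  rw [integral_zero] at hzero
  have hlim2 := ENNReal.tendsto_ofReal
    ((tendsto_const_nhds (x := meanTime rate C FinLower.empty)).sub hzero)
  rw [sub_zero] at hlim2
  exact tendsto_nhds_unique hmono hlim2

end Trajectories

/-! ### Steadiness, linear growth and the limits -/

section Limits

variable {M : Type*} [CommMonoid M] [PartialOrder M] [IsOrderedCancelMonoid M]
  [CanonicallyOrderedMul M] {S : Finset M}

theorem getLast_eq_of_covers_Iic_eq_empty {A : Finset M} {x y : M} (hA : (A : Set M) = Set.Iic x)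
    (hy : y ∈ A) (h : covers A y = ∅) : y = x := by
  classical
  have hmem : ∀ {z}, z ∈ A ↔ z ≤ x := fun {z} => by rw [← Finset.mem_coe, hA, Set.mem_Iic]
  by_contra hne
  have hlt : y < x := lt_of_le_of_ne (hmem.1 hy) hne
  obtain ⟨z, hz⟩ := (A.filter (y < ·)).exists_minimal
    ⟨x, Finset.mem_filter.2 ⟨hmem.2 le_rfl, hlt⟩⟩
  have hzA := Finset.mem_filter.1 hz.prop
  have : z ∈ covers A y := mem_covers.2 ⟨hzA.1, hzA.2, fun w hyw hwz => hwz.not_ge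
    (hz.2 (Finset.mem_filter.2 ⟨hmem.2 (hwz.le.trans (hmem.1 hzA.1)), hyw⟩) hwz.le)⟩
  simp [h] at this

/-- Maximal paths below x all run from 1 to x, so their lengths, less one, count the generators in
factorizations of x. -/
theorem steady_of_closure_eq_top (hS : Submonoid.closure (S : Set M) = ⊤) (h1 : (1 : M) ∉ S) :
    Steady M := by
  obtain ⟨C, hC⟩ := exists_length_le_of_isChain_covBy hS h1
  refine ⟨C + 1, by simp, fun x => ?_⟩
  have hfin : (Set.Iic x).Finite := (locFinite_of_closure_eq_top hS h1).finite_below x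
  obtain ⟨A, hA⟩ := hfin.exists_finset_coe
  have h1A : (1 : M) ∈ A := by rw [← Finset.mem_coe, hA]; exact one_le
  rw [← hA, maxPaths_eq h1A]
  refine ⟨?_, fun p hp q hq => ?_⟩
  · have h := le_chainSum A le_rfl (1 : M)
    rw [chainSum_one] at h
    exact Finset.coe_nonempty.2 (Finset.card_pos.1 (by exact_mod_cast zero_lt_one.trans_le h))
  · obtain ⟨t, rfl, htc, htA, htl⟩ := (mem_maxFrom h1A).1 hp
    obtain ⟨t', rfl, htc', htA', htl'⟩ := (mem_maxFrom h1A).1 hq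
    have e := getLast_eq_of_covers_Iic_eq_empty hA (htA _ (List.getLast_mem _)) htl
    have e' := getLast_eq_of_covers_Iic_eq_empty hA (htA' _ (List.getLast_mem _)) htl'
    obtain ⟨m, hm, hcard, hprod⟩ := exists_multiset_of_isChain_covBy hS h1 t' 1 htc'
    have h := hC t m htc hm (by rw [e, ← e', ← hprod, one_mul])
    have h' : (t.length : ℝ) ≤ C * t'.length := by rw [← hcard]; exact_mod_cast h
    have h0 : (0 : ℝ) ≤ t'.length := Nat.cast_nonneg _
    have h0' : (0 : ℝ) ≤ C := Nat.cast_nonneg _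
    simp only [List.length_cons, Nat.cast_add, Nat.cast_one]
    nlinarith

theorem card_covers_le (hS : Submonoid.closure (S : Set M) = ⊤) (h1 : (1 : M) ∉ S) (A : Finset M)
    (x : M) : (covers A x).card ≤ S.card := by
  classical
  refine (Finset.card_le_card fun y hy => ?_).trans (Finset.card_image_le (f := (x * ·)))
  obtain ⟨s, hs, rfl⟩ := exists_mul_eq_of_covBy hS h1 (mem_covers.1 hy).2
  exact Finset.mem_image_of_mem _ hs

/-- A Kraft inequality: every element has at most |S| upper neighbors. It bounds the number of
maximal chains by (|S|+1) to the maximal length. -/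
theorem chainSum_inv_le_one (hS : Submonoid.closure (S : Set M) = ⊤) (h1 : (1 : M) ∉ S)
    (A : Finset M) (x : M) : chainSum A ((S.card : ℝ) + 1)⁻¹ x ≤ 1 := by
  have hpos : (0 : ℝ) < S.card + 1 := by positivity
  induction x using covers_induction A with
  | h x ih =>
    by_cases h : covers A x = ∅
    · rw [chainSum_of_covers_eq_empty h]
      exact inv_le_one_of_one_le₀ (by simp)
    · rw [chainSum_of_covers_ne_empty h, inv_mul_le_iff₀ hpos, mul_one]
      refine (Finset.sum_le_card_nsmul _ _ 1 ih).trans ?_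
      have : ((covers A x).card : ℝ) ≤ S.card := by exact_mod_cast card_covers_le hS h1 A x
      simp only [nsmul_eq_mul, mul_one]
      linarith

theorem width_le_len_mul (hS : Submonoid.closure (S : Set M) = ⊤) (h1 : (1 : M) ∉ S)
    {A : Finset M} (h1A : (1 : M) ∈ A) :
    width (A : Set M) ≤ len (A : Set M) * Real.log (S.card + 1) := by
  have hpos : (0 : ℝ) < S.card + 1 := by positivity
  have hle : ((maxFrom A (1 : M)).card : ℝ) * ((S.card : ℝ) + 1)⁻¹ ^ len (A : Set M) ≤ 1 := by
    refine le_trans ?_ (chainSum_inv_le_one hS h1 A 1)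
    rw [← nsmul_eq_mul]
    refine Finset.card_nsmul_le_sum _ _ _ fun l hl => ?_
    refine pow_le_pow_of_le_one (inv_nonneg.2 hpos.le) (inv_le_one_of_one_le₀ (by simp))
      (length_le_len ?_)
    have : l ∈ maxPaths (A : Set M) := by rw [maxPaths_eq h1A]; exact hl
    exact this.1
  rw [inv_pow, ← div_eq_mul_inv, div_le_one (pow_pos hpos _), ← chainSum_one] at hle
  rw [width_eq h1A, ← Real.log_pow]
  exact Real.log_le_log (zero_lt_one.trans_le (le_chainSum A le_rfl 1)) hle

theorem exists_len_lowerPow_le (hS : Submonoid.closure (S : Set M) = ⊤) (h1 : (1 : M) ∉ S)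
    {A : Set M} (hA : A.Finite) :
    ∃ K : ℝ, 0 ≤ K ∧ ∀ n : ℕ, 0 < n → (len (lowerPow A n) : ℝ) ≤ K * n := by
  obtain ⟨C, hC⟩ := exists_length_le_of_isChain_covBy hS h1
  obtain ⟨K, hK⟩ := exists_multiset_of_mem_lowerPow hS hA
  -- The extra 1 pays for the initial vertex of the path, using n ≥ 1.
  refine ⟨C * K + 1, by positivity, fun n hn => ?_⟩
  obtain ⟨Z, hZ⟩ := (finite_lowerPow (locFinite_of_closure_eq_top hS h1) hA n).exists_finset_coe
  obtain ⟨p, hp, hpl⟩ := exists_path_length_eq_len Z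
  rw [hZ] at hp hpl
  rw [← hpl]
  cases p with
  | nil => simp only [List.length_nil, Nat.cast_zero]; positivity
  | cons x t =>
    obtain rfl : x = 1 := isMin_iff_eq_one.1 (hp.1.1 x rfl)
    obtain ⟨m, hm, hc, hle⟩ := hK n _ (hp.2 _ (List.getLast_mem (List.cons_ne_nil 1 t)))
    have h2 : t.length ≤ C * (K * n) :=
      (hC t m hp.1.2 hm hle).trans (Nat.mul_le_mul_left C hc)
    have h3 : (t.length : ℝ) ≤ C * (K * n) := by exact_mod_cast h2
    have h4 : (1 : ℝ) ≤ n := by exact_mod_cast hn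
    simp only [List.length_cons, Nat.cast_add, Nat.cast_one]
    linarith

theorem exists_limits_of_nonempty (hS : Submonoid.closure (S : Set M) = ⊤) (h1 : (1 : M) ∉ S)
    {rate : M → ℝ} {r : ℝ} (h0 : 0 < r) (hr : ∀ x, r ≤ rate x) (hrate : Antitone rate)
    {A : Set M} (hne : A.Nonempty) {Z : ℕ → Finset M} (hA : A.Finite)
    (hZ : ∀ n, (Z n : Set M) = lowerPow A n) :
    ∃ g k l : ℝ,
      Tendsto (fun n : ℕ => width (lowerPow A n) / (n : ℝ)) atTop (𝓝 k) ∧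
      Tendsto (fun n : ℕ => (len (lowerPow A n) : ℝ) / (n : ℝ)) atTop (𝓝 l) ∧
      g ≤ 1 / r * (√k + √l) ^ 2 ∧
      Tendsto (fun n : ℕ => meanTime rate (Z n) FinLower.empty / (n : ℝ)) atTop (𝓝 g) := by
  have hr0 : ∀ x, 0 < rate x := fun x => h0.trans_le (hr x)
  have hmem : ∀ {n x}, x ∈ Z n ↔ x ∈ lowerPow A n := fun {n x} => by
    rw [← Finset.mem_coe, hZ]
  have hone : ∀ n, (1 : M) ∈ Z n := fun n => hmem.2 (one_mem_lowerPow hne n)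
  have hlow : ∀ n, IsLowerSet (Z n : Set M) := fun n => by
    rw [hZ]; exact isLowerSet_lowerPow A n
  have hmul : ∀ m n, ∀ a ∈ Z m, ∀ x ∈ Z n, a * x ∈ Z (m + n) := fun m n a ha x hx =>
    hmem.2 (mul_mem_lowerPow_add (hmem.1 hx) (hmem.1 ha))
  have hsub : ∀ m n, Z m ⊆ Z (m + n) := fun m n a ha => by
    simpa using hmul m n a ha 1 (hone n)
  obtain ⟨K, hK0, hK⟩ := exists_len_lowerPow_le hS h1 hA
  have hlog : 0 ≤ Real.log ((S.card : ℝ) + 1) := Real.log_nonneg (by simp)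
  have hW : ∀ n : ℕ, 0 < n → width (lowerPow A n) ≤ K * Real.log (S.card + 1) * n := by
    intro n hn
    have h := width_le_len_mul hS h1 (hone n)
    rw [hZ] at h
    exact h.trans ((mul_le_mul_of_nonneg_right (hK n hn) hlog).trans (le_of_eq (by ring)))
  have hT : ∀ n : ℕ, ∀ s : ℝ, 0 < s → s < 1 → meanTime rate (Z n) FinLower.empty ≤
      1 / r * (width (lowerPow A n) / s + len (lowerPow A n) / (1 - s)) := fun n s hs hs1 => by
    rw [← hZ]; exact meanTime_le_width_add_len h0 hr hs hs1 (hone n)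
  obtain ⟨k, hk⟩ := exists_tendsto_div_of_superadditive (u := fun n => width (lowerPow A n))
    (c := 0) (fun m n => by
      have := width_add_width_le (hone m) (hone n) (hsub m n) (hmul m n)
      simpa only [hZ, add_zero] using this) hW
  obtain ⟨l, hl⟩ := exists_tendsto_div_of_superadditive
    (u := fun n => (len (lowerPow A n) : ℝ)) (c := 1) (fun m n => by
      have := len_add_len_le (C := Z n) (hone m) (hsub m n) (hmul m n)
      simp only [hZ] at this
      exact_mod_cast this) hK
  obtain ⟨g, hg⟩ := exists_tendsto_div_of_superadditive
    (u := fun n => meanTime rate (Z n) FinLower.empty) (c := (rate 1)⁻¹)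
    -- For linear growth any fixed s will do; here s = 1/2.
    (K := 1 / r * (K * Real.log (S.card + 1) / (1 / 2) + K / (1 - 1 / 2))) (fun m n =>
      meanTime_add_meanTime_le hr0 hrate (hlow m) (hlow n) (hlow _) (hone m) (hone n)
        (hsub m n) (hmul m n)) (fun n hn => by
      refine (hT n (1 / 2) (by norm_num) (by norm_num)).trans ?_
      have h2 := hW n hn
      have h3 := hK n hn
      have h4 : (0 : ℝ) ≤ 1 - 1 / 2 := by norm_num
      exact (mul_le_mul_of_nonneg_left (add_le_add
        (div_le_div_of_nonneg_right h2 one_half_pos.le) (div_le_div_of_nonneg_right h3 h4))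
        (one_div_nonneg.2 h0.le)).trans (le_of_eq (by ring)))
  refine ⟨g, k, l, hk, hl, ?_, hg⟩
  have hk0 : 0 ≤ k := ge_of_tendsto' hk fun n => div_nonneg (width_nonneg _) n.cast_nonneg
  have hl0 : 0 ≤ l := ge_of_tendsto' hl fun n => div_nonneg (Nat.cast_nonneg _) n.cast_nonneg
  rw [one_div, ← div_eq_inv_mul, le_div_iff₀' h0]
  refine le_sq_sqrt_add_sqrt hk0 hl0 fun s hs hs1 => ?_
  rw [← le_div_iff₀' h0, div_eq_inv_mul, ← one_div]
  refine le_of_tendsto_of_tendsto' hg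
    (((hk.div_const s).add (hl.div_const (1 - s))).const_mul (1 / r)) fun n => ?_
  refine (div_le_div_of_nonneg_right (hT n s hs hs1) n.cast_nonneg).trans (le_of_eq ?_)
  ring

theorem lowerPow_empty {n : ℕ} (hn : 0 < n) : lowerPow (∅ : Set M) n = ∅ := by
  cases n with
  | zero => exact absurd hn (lt_irrefl 0)
  | succ n => simp [lowerPow, lowerMul]

theorem tendsto_div_of_lowerPow_empty (u : Set M → ℝ) :
    Tendsto (fun n : ℕ => u (lowerPow (∅ : Set M) n) / (n : ℝ)) atTop (𝓝 0) :=
  (tendsto_const_div_atTop_nhds_zero_nat (u ∅)).congr'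
    ((eventually_gt_atTop 0).mono fun n hn => by
      simp only [lowerPow_empty hn])

end Limits

/-! ### The positive cone as a canonically ordered monoid -/

section Cone

variable {G : Type*} [CommGroup G] [PartialOrder G] [IsOrderedMonoid G]

theorem canonicallyOrderedMul_oneLE : CanonicallyOrderedMul (Submonoid.oneLE G) where
  exists_mul_of_le {a b} h := ⟨⟨(a : G)⁻¹ * b, le_inv_mul_iff_mul_le.2 (by simpa using h)⟩,
    Subtype.ext (by simp)⟩
  le_mul_self a b := Subtype.coe_le_coe.1 (by
    simpa using (show (1 : G) ≤ b from b.2))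
  le_self_mul a b := Subtype.coe_le_coe.1 (by
    simpa using (show (1 : G) ≤ b from b.2))

/-- Some generators may be trivial in the group. Discarding 1 does not change the generated
submonoid, and the length comparison needs it. -/
theorem exists_finset_closure_eq_top {N : Submonoid G} {T : Set G} (hT : T.Finite)
    (h : Submonoid.closure T = N) :
    ∃ S : Finset N, Submonoid.closure (S : Set N) = ⊤ ∧ (1 : N) ∉ S := by
  classical
  subst h
  have hfin : ((↑) ⁻¹' T : Set (Submonoid.closure T)).Finite :=
    hT.preimage Subtype.val_injective.injOn
  refine ⟨hfin.toFinset.erase 1, ?_, by simp⟩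
  rw [eq_top_iff, ← Submonoid.closure_closure_coe_preimage, Submonoid.closure_le]
  intro x hx
  by_cases hx1 : x = 1
  · rw [hx1]; exact one_mem _
  · exact Submonoid.subset_closure (by simpa [hx1] using hx)

end Cone

end CrystalGrowth

open CrystalGrowth in
theorem corollary3p15 {G : Type*} [CommGroup G] [PartialOrder G] [IsOrderedMonoid G]
    {S : Type*} [Finite S] (R : Set (FreeGroup S)) (hR : R.Finite) (e : PresentedGroup R ≃* G)
    (hS : Submonoid.closure (Set.range fun s : S => e (PresentedGroup.of s))
      = Submonoid.oneLE G) :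
    CrystalGrowth.Steady (Submonoid.oneLE G) ∧
    CrystalGrowth.LocFinite (Submonoid.oneLE G) ∧
    ∀ rate : Submonoid.oneLE G → ℝ, (∀ x, 0 < rate x) → 0 < ⨅ x, rate x →
      BddAbove (Set.range rate) → Antitone rate →
      ∀ A : CrystalGrowth.FinLower (Submonoid.oneLE G), ∃ g k l : ℝ,
        Tendsto (fun n : ℕ =>
          CrystalGrowth.width (CrystalGrowth.lowerPow A.carrier n) / (n : ℝ)) atTop (𝓝 k) ∧
        Tendsto (fun n : ℕ =>
          (CrystalGrowth.len (CrystalGrowth.lowerPow A.carrier n) : ℝ) / (n : ℝ)) atTop (𝓝 l) ∧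
        g ≤ 1 / (⨅ x, rate x) * (√k + √l) ^ 2 ∧
        ∀ (Ω : Type*) (m : MeasurableSpace Ω) (P : Measure Ω) (F : Filtration ℝ≥0 m)
          (X : ℝ≥0 → Ω → CrystalGrowth.FinLower (Submonoid.oneLE G)),
          IsProbabilityMeasure P → CrystalGrowth.IsGrowthProcess rate P F X →
          (∀ n : ℕ, AEMeasurable
            (CrystalGrowth.hitTime X (CrystalGrowth.lowerPow A.carrier n)) P) ∧
          (∀ n : ℕ,
            ∫⁻ ω, CrystalGrowth.hitTime X (CrystalGrowth.lowerPow A.carrier n) ω ∂P ≠ ∞) ∧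
          Tendsto (fun n : ℕ =>
            (∫⁻ ω, CrystalGrowth.hitTime X (CrystalGrowth.lowerPow A.carrier n) ω ∂P).toReal
              / (n : ℝ)) atTop (𝓝 g) := by
  have := canonicallyOrderedMul_oneLE (G := G)
  obtain ⟨S, hS, h1⟩ := exists_finset_closure_eq_top (Set.finite_range _) hS
  have hLF := locFinite_of_closure_eq_top hS h1
  refine ⟨steady_of_closure_eq_top hS h1, hLF, fun rate hpos hinf _ hanti A => ?_⟩
  have hr : ∀ x, ⨅ x, rate x ≤ rate x := fun x =>
    ciInf_le ⟨0, by rintro _ ⟨y, rfl⟩; exact (hpos y).le⟩ x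
  choose Z hZ using fun n => (finite_lowerPow hLF A.finite n).exists_finset_coe
  have hlow : ∀ n, IsLowerSet (Z n : Set (Submonoid.oneLE G)) := fun n => by
    rw [hZ]; exact isLowerSet_lowerPow A.carrier n
  have key : ∃ g k l : ℝ,
      Tendsto (fun n : ℕ => width (lowerPow A.carrier n) / (n : ℝ)) atTop (𝓝 k) ∧
      Tendsto (fun n : ℕ => (len (lowerPow A.carrier n) : ℝ) / (n : ℝ)) atTop (𝓝 l) ∧
      g ≤ 1 / (⨅ x, rate x) * (√k + √l) ^ 2 ∧
      Tendsto (fun n : ℕ => meanTime rate (Z n) FinLower.empty / (n : ℝ)) atTop (𝓝 g) := by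
    -- For empty A the positive powers are empty and do not contain 1, so superadditivity is not
    -- available, but all limits are 0.
    rcases A.carrier.eq_empty_or_nonempty with hA | hA
    · refine ⟨0, 0, 0, ?_, ?_, by simp, ?_⟩
      · rw [hA]; exact tendsto_div_of_lowerPow_empty width
      · rw [hA]; exact tendsto_div_of_lowerPow_empty fun B => (len B : ℝ)
      · refine tendsto_const_nhds.congr' ((eventually_gt_atTop 0).mono fun n hn => ?_)
        have : (Z n : Set (Submonoid.oneLE G)) = ∅ := by rw [hZ, hA, lowerPow_empty hn]
        have h0 : meanTime rate (Z n) FinLower.empty = 0 :=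
          meanTime_of_subset (by rw [this]; exact Set.empty_subset _)
        simp only [h0, zero_div]
    · exact exists_limits_of_nonempty hS h1 hinf hr hanti hA A.finite hZ
  obtain ⟨g, k, l, hk, hl, hle, hg⟩ := key
  refine ⟨g, k, l, hk, hl, hle, fun Ω m P F X hP hX => ?_⟩
  have hint : ∀ n, ∫⁻ ω, hitTime X (lowerPow A.carrier n) ω ∂P =
      ENNReal.ofReal (meanTime rate (Z n) FinLower.empty) := fun n => by
    rw [← hZ]; exact hX.lintegral_hitTime hpos (hlow n)
  refine ⟨fun n => (hX.measurable_hitTime _).aemeasurable,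
    fun n => by rw [hint]; exact ENNReal.ofReal_ne_top, hg.congr fun n => ?_⟩
  rw [hint, ENNReal.toReal_ofReal (meanTime_nonneg hpos _)]
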